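/- **Notation.** Fix $\lambda\in\{1,-1\}$ and $s\in\mathbb C$; powers are principal branches. Put $T=\begin{pmatrix}1&1\\0&1\end{pmatrix}$, $M=\begin{pmatrix}0&1\\1&0\end{pmatrix}$, $Q=\begin{pmatrix}0&-1\\1&0\end{pmatrix}$. For $n\ge 1$ let $\overline\Gamma_0(n)$ be the group of matrices in $\mathrm{GL}(2,\mathbb Z)$ whose lower left entry is divisible by $n$. *Index set.* On $\mathbb Z^2$ write $(x,y)\sim_n(x',y')$ if $kx\equiv x'$ and $ky\equiv y' \pmod n$ for some $k$ prime to $n$, and let $[x:y]$ be the class of $(x,y)$. $\mathrm{GL}(2,\mathbb Z)$ acts from the right by $[x:y]\begin{pmatrix}a&b\\c&d\end{pmatrix}=[ax+cy:bx+dy]$, and $I_n$ is the orbit of $[0:1]$, that is, $\overline\Gamma_0(n)\backslash \mathrm{GL}(2,\mathbb Z)$. For $m\mid n$ let $\sigma:I_n\to I_m$ be the reduction map $[x:y]\mapsto[x:y]$. *Lewis equations.* A solution of the Lewis equation for $\mathrm{PSL}(2,\mathbb Z)$ of weight $s$ is a function $\phi$, holomorphic on $\mathbb C\setminus(-\infty,0]$,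 with $\phi(z)=\phi(z+1)+\lambda z^{-2s}\phi(1+\frac1z)$ there. A solution of the Lewis system for $\overline\Gamma_0(n)$ of weight $s$ is a family $(\phi_i)_{i\in I_n}$ of functions holomorphic on $\mathbb C\setminus(-\infty,0]$ with $$\phi_i(z)-\phi_{iT^{-1}}(z+1)-\lambda z^{-2s}\phi_{iT^{-1}M}\left(1+\tfrac1z\right)=0\qquad\text{for all } i\in I_n .$$ *Slash action.* For $A=\begin{pmatrix}a&b\\c&d\end{pmatrix}$ put $(\phi|_sA)(z)=|\det A|^s(cz+d)^{-2s}\phi\left(\frac{az+b}{cz+d}\right)$, extended linearly to finite integer combinations of integer matrices. *The elements $\tilde\psi_i$.* Let $S_n$ be the (finite) set of integer matrices $\begin{pmatrix}a&b\\c&d\end{pmatrix}$ with $a>c\ge0$, $d>b\ge0$, $ad-bc=n$, and $Y_n\subset S_n$ the subset of the matrices $\begin{pmatrix}c&0\\a&n/c\end{pmatrix}$ with $c\mid n$, $0\le a<c$. For $A=\begin{pmatrix}a&b\\c&d\end{pmatrix}\in S_n\setminus Y_n$ put $K(A)=T^{\lceil d/b\rceil}QA$. A pair $(c,b)$ is $n$-admissible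 if $c\ge1$, $c\mid n$, $0\le b<\frac nc$ and $\gcd(c,b+k\frac nc)=1$ for some $0\le k<c$; then $d(c,b)$ is the least $c+b+k\frac nc$ with $0\le k<c$ and $\gcd(c,b+k\frac nc)=1$. The map $(c,b)\mapsto[c:d(c,b)]$ is a bijection from the $n$-admissible pairs onto $I_n$; for $i=[c:d(c,b)]$ put $A_i=\begin{pmatrix}c&b\\0&n/c\end{pmatrix}$ and $\tilde\psi_i=\sum_{j=0}^{k_i}K^j(A_i)$, where $k_i$ is the least $j$ with $K^j(A_i)\in Y_n$. *Hecke operators.* $T_n=\sum_{A\in S_n}A$, and $\tilde T_n$ is the sum of those $A\in S_n$ whose four entries have greatest common divisor $1$. **Statement.** Let $n\ge1$ and let $\phi$ be a solution of the Lewis equation for $\mathrm{PSL}(2,\mathbb Z)$ of weight $s$. 1. Let $d\ge 1$ with $d^2\mid n$. The family $(\phi|_s\tilde\psi_i)_{i\in I_{n/d^2}}$ solves the Lewis system for $\overline\Gamma_0(n/d^2)$, and its pullback $\tilde\phi_{j,d}:=\phi|_s\tilde\psi_{\sigma(j)}$, $j\in I_n$, under the reduction $\sigma:I_n\to I_{n/d^2}$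 solves the Lewis system for $\overline\Gamma_0(n)$, both with weight $s$ and the same $\lambda$. 2. With $\mu_d=[\overline\Gamma_0(n/d^2):\overline\Gamma_0(n)]$, on $\mathbb C\setminus(-\infty,0]$ $$\tilde\phi_d:=\frac1{\mu_d}\sum_{j\in I_n}\tilde\phi_{j,d}=\phi|_s\tilde T_{n/d^2},$$ and $\tilde\phi_d$ is a solution of the Lewis equation for $\mathrm{PSL}(2,\mathbb Z)$ of weight $s$ (with the same $\lambda$). 3. In the ring of finite integer combinations of integer matrices, $T_n=\sum_{d\ge1,\ d^2\mid n}\begin{pmatrix}d&0\\0&d\end{pmatrix}\tilde T_{n/d^2}$, and on $\mathbb C\setminus(-\infty,0]$ $$\phi|_sT_n=\sum_{d\ge1,\ d^2\mid n}\tilde\phi_d=\sum_{d\ge1,\ d^2\mid n}\frac1{\mu_d}\sum_{j\in I_n}\tilde\phi_{j,d}.$$ In particular $\phi|_sT_n$ is a solution of the Lewis equation for $\mathrm{PSL}(2,\mathbb Z)$ of weight $s$ (with the same $\lambda$). -/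

import Mathlib

namespace Lewis

/-! ### The indexing set `I_n` -/

/-- `(x, y) ∼_n (x', y')` iff `k x ≡ x'` and `k y ≡ y'` modulo `n` for some `k` prime to `n`. -/
def projRel (n : ℕ) (p q : ℤ × ℤ) : Prop :=
  ∃ k : ℤ, IsCoprime k (n : ℤ) ∧ k * p.1 ≡ q.1 [ZMOD n] ∧ k * p.2 ≡ q.2 [ZMOD n]

theorem projRel_refl (n : ℕ) (p : ℤ × ℤ) : projRel n p p :=
  ⟨1, isCoprime_one_left, by simp [Int.ModEq], by simp [Int.ModEq]⟩

theorem projRel_symm {n : ℕ} {p q : ℤ × ℤ} (h : projRel n p q) : projRel n q p := by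
  obtain ⟨k, ⟨u, v, huv⟩, h1, h2⟩ := h
  have hu : u * k ≡ 1 [ZMOD n] := by
    refine (Int.modEq_iff_dvd.2 ⟨v, ?_⟩)
    linear_combination -huv
  refine ⟨u, ⟨k, v, by linear_combination huv⟩, ?_, ?_⟩
  · calc u * q.1 ≡ u * (k * p.1) [ZMOD n] := (h1.symm.mul_left u)
      _ = (u * k) * p.1 := by ring
      _ ≡ 1 * p.1 [ZMOD n] := hu.mul_right _
      _ = p.1 := one_mul _
  · calc u * q.2 ≡ u * (k * p.2) [ZMOD n] := (h2.symm.mul_left u)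
      _ = (u * k) * p.2 := by ring
      _ ≡ 1 * p.2 [ZMOD n] := hu.mul_right _
      _ = p.2 := one_mul _

theorem projRel_trans {n : ℕ} {p q r : ℤ × ℤ} (h : projRel n p q) (h' : projRel n q r) :
    projRel n p r := by
  obtain ⟨k, hk, h1, h2⟩ := h
  obtain ⟨l, hl, h3, h4⟩ := h'
  refine ⟨l * k, hl.mul_left hk, ?_, ?_⟩
  · rw [mul_assoc]; exact (h1.mul_left l).trans h3
  · rw [mul_assoc]; exact (h2.mul_left l).trans h4

/-- The equivalence relation `∼_n` on `ℤ × ℤ`. -/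
def projSetoid (n : ℕ) : Setoid (ℤ × ℤ) where
  r := projRel n
  iseqv := ⟨projRel_refl n, projRel_symm, projRel_trans⟩

/-- The space `[ℤ : ℤ]_n` of classes `[x : y]`. -/
def ProjPair (n : ℕ) : Type := Quotient (projSetoid n)

/-- The class `[x : y]`. -/
def ProjPair.mk (n : ℕ) (x y : ℤ) : ProjPair n := Quotient.mk (projSetoid n) (x, y)

/-- The right action `[x : y] (a b; c d) = [a x + c y : b x + d y]`. -/
def ProjPair.act {n : ℕ} (p : ProjPair n) (g : Matrix (Fin 2) (Fin 2) ℤ) : ProjPair n :=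
  Quotient.map (sa := projSetoid n) (sb := projSetoid n)
    (fun q : ℤ × ℤ => (g 0 0 * q.1 + g 1 0 * q.2, g 0 1 * q.1 + g 1 1 * q.2))
    (by
      rintro p q ⟨k, hk, h1, h2⟩
      refine ⟨k, hk, ?_, ?_⟩
      · have := (h1.mul_left (g 0 0)).add (h2.mul_left (g 1 0))
        convert this using 1; ring
      · have := (h1.mul_left (g 0 1)).add (h2.mul_left (g 1 1))
        convert this using 1; ring) p

theorem ProjPair.act_act {n : ℕ} (p : ProjPair n) (g h : Matrix (Fin 2) (Fin 2) ℤ) :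
    (p.act g).act h = p.act (g * h) := by
  induction p using Quotient.inductionOn with
  | h q =>
    refine congrArg (Quotient.mk (projSetoid n)) (Prod.ext ?_ ?_) <;>
    · simp only [Matrix.mul_apply, Fin.sum_univ_two]; ring

/-- `I_n`: the `GL(2, ℤ)`-orbit of `[0 : 1]` in `[ℤ : ℤ]_n`. The stabilizer of `[0 : 1]` is
`Γ̄₀(n)`, so that `I_n` is the coset space `Γ̄₀(n) \ GL(2, ℤ)`. -/
def Idx (n : ℕ) : Type :=
  {p : ProjPair n // ∃ g : GL (Fin 2) ℤ, p = (ProjPair.mk n 0 1).act g.1}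

/-- The right action of `GL(2, ℤ)` on `I_n`. -/
def Idx.act {n : ℕ} (i : Idx n) (g : GL (Fin 2) ℤ) : Idx n :=
  ⟨i.1.act g.1, by
    obtain ⟨h, hh⟩ := i.2
    exact ⟨h * g, by rw [hh, ProjPair.act_act]; rfl⟩⟩

/-- The reduction map `[x : y] ↦ [x : y]` from `[ℤ : ℤ]_n` to `[ℤ : ℤ]_m` for `m ∣ n`. -/
def ProjPair.red {n m : ℕ} (h : m ∣ n) (p : ProjPair n) : ProjPair m :=
  Quotient.map (sa := projSetoid n) (sb := projSetoid m) id
    (by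
      have hz : (m : ℤ) ∣ (n : ℤ) := Int.natCast_dvd_natCast.2 h
      rintro p q ⟨k, hk, h1, h2⟩
      exact ⟨k, hk.of_isCoprime_of_dvd_right hz, h1.of_dvd hz, h2.of_dvd hz⟩) p

/-- The reduction map `σ : I_n → I_m` for `m ∣ n`. -/
def sigma {n m : ℕ} (h : m ∣ n) (i : Idx n) : Idx m :=
  ⟨i.1.red h, by
    obtain ⟨g, hg⟩ := i.2
    exact ⟨g, by rw [hg]; rfl⟩⟩

theorem finite_Idx {n : ℕ} (hn : 0 < n) : Finite (Idx n) := by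
  have hn' : (0 : ℤ) < n := by exact_mod_cast hn
  have : Finite (ProjPair n) := by
    refine Finite.of_surjective
      (fun p : Fin n × Fin n => ProjPair.mk n ((p.1 : ℕ) : ℤ) ((p.2 : ℕ) : ℤ)) ?_
    intro q
    induction q using Quotient.inductionOn with
    | h q =>
      have key : ∀ t : ℤ, ∃ a : Fin n, ((a : ℕ) : ℤ) = t % n := fun t => by
        have h0 := Int.emod_nonneg t hn'.ne'
        have h1 := Int.emod_lt_of_pos t hn'
        exact ⟨⟨(t % n).toNat, by omega⟩, by simp [h0]⟩
      obtain ⟨a, ha⟩ := key q.1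
      obtain ⟨b, hb⟩ := key q.2
      refine ⟨(a, b), Quotient.sound (s := projSetoid n) ⟨1, isCoprime_one_left, ?_, ?_⟩⟩
      · simp only [one_mul, ha]; exact Int.mod_modEq _ _
      · simp only [one_mul, hb]; exact Int.mod_modEq _ _
  exact Subtype.finite

/-- `T = (1 1; 0 1)` as an element of `GL(2, ℤ)`. -/
def matT : GL (Fin 2) ℤ where
  val := !![1, 1; 0, 1]
  inv := !![1, -1; 0, 1]
  val_inv := by decide
  inv_val := by decide

/-- `M = (0 1; 1 0)` as an element of `GL(2, ℤ)`. -/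
def matM : GL (Fin 2) ℤ where
  val := !![0, 1; 1, 0]
  inv := !![0, 1; 1, 0]
  val_inv := by decide
  inv_val := by decide

/-- `Γ̄₀(n)`: the matrices in `GL(2, ℤ)` whose lower left entry is divisible by `n`. -/
def GammaBar (n : ℕ) : Subgroup (GL (Fin 2) ℤ) where
  carrier := {g | (n : ℤ) ∣ g.1 1 0}
  one_mem' := by simp
  mul_mem' := by
    intro g h hg hh
    simp only [Set.mem_ofPred_eq, Units.val_mul, Matrix.mul_apply, Fin.sum_univ_two] at *
    exact dvd_add (hg.mul_right _) (hh.mul_left _)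
  inv_mem' := by
    intro g hg
    simp only [Set.mem_ofPred_eq, Matrix.coe_units_inv, Matrix.inv_def, Matrix.adjugate_fin_two,
      Matrix.smul_apply, smul_eq_mul] at *
    simpa using hg.mul_left (-Ring.inverse g.1.det)

/-! ### The parametrization of `I_n` -/

/-- The `n`-admissible pairs: `c ≥ 1`, `c ∣ n`, `0 ≤ b < n / c`, and `gcd (c, b + k n / c) = 1` for
some `0 ≤ k < c`. -/
def Admissible (n : ℕ) : Type :=
  {p : ℕ × ℕ // 1 ≤ p.1 ∧ p.1 ∣ n ∧ p.2 < n / p.1 ∧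
    ∃ k < p.1, Nat.gcd p.1 (p.2 + k * (n / p.1)) = 1}

/-- `d(c, b) = min {c + b + k n / c : 0 ≤ k < c, gcd (c, b + k n / c) = 1}`. -/
noncomputable def dMin (n c b : ℕ) : ℕ :=
  sInf {e : ℕ | ∃ k < c, Nat.gcd c (b + k * (n / c)) = 1 ∧ e = c + b + k * (n / c)}

theorem dMin_spec {n : ℕ} (p : Admissible n) :
    ∃ k < p.1.1, Nat.gcd p.1.1 (p.1.2 + k * (n / p.1.1)) = 1 ∧
      dMin n p.1.1 p.1.2 = p.1.1 + p.1.2 + k * (n / p.1.1) := by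
  obtain ⟨k, hk, h⟩ := p.2.2.2.2
  exact Nat.sInf_mem
    (s := {e : ℕ | ∃ k < p.1.1, Nat.gcd p.1.1 (p.1.2 + k * (n / p.1.1)) = 1 ∧
      e = p.1.1 + p.1.2 + k * (n / p.1.1)}) ⟨_, k, hk, h, rfl⟩

theorem dMin_coprime {n : ℕ} (p : Admissible n) :
    IsCoprime (p.1.1 : ℤ) (dMin n p.1.1 p.1.2 : ℤ) := by
  obtain ⟨k, -, h, h'⟩ := dMin_spec p
  rw [h', Nat.isCoprime_iff_coprime]
  have h2 : p.1.1 + p.1.2 + k * (n / p.1.1) = p.1.1 + (p.1.2 + k * (n / p.1.1)) := by ring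
  rw [h2]
  simpa using h

theorem dMin_modEq {n : ℕ} (p : Admissible n) :
    (dMin n p.1.1 p.1.2 : ℤ) ≡ p.1.1 + p.1.2 [ZMOD (n / p.1.1 : ℕ)] := by
  obtain ⟨k, -, h, h'⟩ := dMin_spec p
  rw [h']
  refine Int.modEq_iff_dvd.2 ⟨-k, ?_⟩
  push_cast
  ring

/-- A pair of coprime integers is the lower row of an element of `GL(2, ℤ)`. -/
theorem exists_act_eq (n : ℕ) {x y : ℤ} (h : IsCoprime x y) :
    ∃ g : GL (Fin 2) ℤ, ProjPair.mk n x y = (ProjPair.mk n 0 1).act g.1 := by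
  obtain ⟨u, v, huv⟩ := h
  refine ⟨⟨!![v, -u; x, y], !![y, u; -x, v], ?_, ?_⟩, ?_⟩
  · ext i j; fin_cases i <;> fin_cases j <;> simp [Matrix.mul_apply, Fin.sum_univ_two] <;>
      linarith
  · ext i j; fin_cases i <;> fin_cases j <;> simp [Matrix.mul_apply, Fin.sum_univ_two] <;>
      linarith
  · refine congrArg (Quotient.mk (projSetoid n)) (Prod.ext ?_ ?_) <;> simp

/-- The map `(c, b) ↦ [c : d(c, b)]`. -/
noncomputable def paramMap (n : ℕ) (p : Admissible n) : Idx n :=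
  ⟨ProjPair.mk n p.1.1 (dMin n p.1.1 p.1.2), exists_act_eq n (dMin_coprime p)⟩

/-- If no prime divides all of `a`, `b`, `c`, then `a` is prime to some `b + k c`. -/
theorem exists_coprime_add_mul {a : ℕ} (ha : a ≠ 0) (b c : ℤ)
    (h : ∀ p : ℕ, p.Prime → p ∣ a → (p : ℤ) ∣ b → ¬ (p : ℤ) ∣ c) :
    ∃ k : ℤ, IsCoprime (b + k * c) (a : ℤ) := by
  classical
  let ps : Finset ℕ := {p ∈ a.primeFactors | ¬ (p : ℤ) ∣ b}
  refine ⟨((ps.prod id : ℕ) : ℤ), ?_⟩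
  rw [Int.isCoprime_iff_gcd_eq_one]
  refine Nat.Coprime.symm (Nat.coprime_of_dvd ?_)
  intro p pp hpa hp
  have hpa' : p ∣ a := by simpa using hpa
  have hp' : (p : ℤ) ∣ b + ((ps.prod id : ℕ) : ℤ) * c := Int.natCast_dvd.2 hp
  by_cases hb : (p : ℤ) ∣ b
  · have h1 : (p : ℤ) ∣ ((ps.prod id : ℕ) : ℤ) * c := (dvd_add_right hb).1 hp'
    rcases (Nat.prime_iff_prime_int.1 pp).dvd_or_dvd h1 with h2 | h2
    · obtain ⟨q, hq, hq'⟩ := (pp.prime.dvd_finsetProd_iff id).mp (Int.natCast_dvd_natCast.1 h2)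
      rw [Finset.mem_filter, Nat.mem_primeFactors] at hq
      have : p = q := (Nat.prime_dvd_prime_iff_eq pp hq.1.1).mp hq'
      exact hq.2 (this ▸ hb)
    · exact h p pp hpa' hb h2
  · have hps : p ∈ ps := Finset.mem_filter.mpr ⟨Nat.mem_primeFactors.mpr ⟨pp, hpa', ha⟩, hb⟩
    have h1 : (p : ℤ) ∣ ((ps.prod id : ℕ) : ℤ) :=
      Int.natCast_dvd_natCast.2 (Finset.dvd_prod_of_mem id hps)
    exact hb ((dvd_add_left (h1.mul_right c)).1 hp')

theorem cast_mul_div {n : ℕ} (p : Admissible n) :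
    (p.1.1 : ℤ) * ((n / p.1.1 : ℕ) : ℤ) = n := by
  exact_mod_cast Nat.mul_div_cancel' p.2.2.1

theorem paramMap_injective (n : ℕ) : Function.Injective (paramMap n) := by
  have key : ∀ p q : Admissible n, paramMap n p = paramMap n q → p.1.1 ∣ q.1.1 := by
    intro p q h
    obtain ⟨k, hk, h1, h2⟩ := Quotient.exact (s := projSetoid n) (congrArg Subtype.val h)
    have h1' : (n : ℤ) ∣ q.1.1 - k * (p.1.1 : ℤ) := Int.modEq_iff_dvd.1 h1
    have h3 : (p.1.1 : ℤ) ∣ q.1.1 - k * (p.1.1 : ℤ) :=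
      (Int.natCast_dvd_natCast.2 p.2.2.1).trans h1'
    exact Int.natCast_dvd_natCast.1 ((dvd_sub_left (dvd_mul_left _ _)).1 h3)
  intro p q h
  have hc : p.1.1 = q.1.1 := Nat.dvd_antisymm (key p q h) (key q p h.symm)
  obtain ⟨k, hk, h1, h2⟩ := Quotient.exact (s := projSetoid n) (congrArg Subtype.val h)
  have h1' : (n : ℤ) ∣ q.1.1 - k * (p.1.1 : ℤ) := Int.modEq_iff_dvd.1 h1
  have h2' : k * (dMin n p.1.1 p.1.2 : ℤ) ≡ dMin n q.1.1 q.1.2 [ZMOD n] := h2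
  have hn := cast_mul_div p
  have hk1 : k ≡ 1 [ZMOD (n / p.1.1 : ℕ)] := by
    refine Int.modEq_iff_dvd.2 ?_
    rw [← hc, ← hn] at h1'
    have h0 : (p.1.1 : ℤ) ≠ 0 := by have := p.2.1; omega
    refine (mul_dvd_mul_iff_left h0).1 ?_
    have h3 : (p.1.1 : ℤ) * (1 - k) = p.1.1 - k * p.1.1 := by ring
    rw [h3]; exact h1'
  have hD : (dMin n p.1.1 p.1.2 : ℤ) ≡ dMin n q.1.1 q.1.2 [ZMOD (n / p.1.1 : ℕ)] := by
    have h3 := (hk1.mul_right (dMin n p.1.1 p.1.2 : ℤ)).symm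
    rw [one_mul] at h3
    exact h3.trans (h2'.of_dvd ⟨_, by rw [← hn]; ring⟩)
  have hq := dMin_modEq q
  rw [← hc] at hq hD
  have hb : (p.1.1 : ℤ) + p.1.2 ≡ p.1.1 + q.1.2 [ZMOD (n / p.1.1 : ℕ)] :=
    ((dMin_modEq p).symm.trans hD).trans hq
  have hb' := Int.ModEq.add_left_cancel' _ hb
  have hbn : p.1.2 % (n / p.1.1) = q.1.2 % (n / p.1.1) := (Int.natCast_modEq_iff).1 hb'
  have hq2 : q.1.2 < n / p.1.1 := by rw [hc]; exact q.2.2.2.1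
  rw [Nat.mod_eq_of_lt p.2.2.2.1, Nat.mod_eq_of_lt hq2] at hbn
  exact Subtype.ext (Prod.ext hc hbn)

theorem paramMap_surjective {n : ℕ} (hn : 0 < n) : Function.Surjective (paramMap n) := by
  rintro ⟨i, g, rfl⟩
  set x : ℤ := g.1 1 0 with hx
  set y : ℤ := g.1 1 1 with hy
  have hxy : IsCoprime x y := by
    have h1 : g.1 * g⁻¹.1 = 1 := by simp
    have h2 := congrFun (congrFun h1 1) 1
    rw [Matrix.mul_apply, Fin.sum_univ_two] at h2
    exact ⟨g⁻¹.1 0 1, g⁻¹.1 1 1, by simpa [mul_comm] using h2⟩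
  have hi : (ProjPair.mk n 0 1).act g.1 = ProjPair.mk n x y :=
    congrArg (Quotient.mk (projSetoid n)) (Prod.ext (by simp [hx]) (by simp [hy]))
  -- the divisor `c`
  obtain ⟨c, hc⟩ : ∃ c : ℕ, c = Int.gcd x n := ⟨_, rfl⟩
  have hc0 : 0 < c := hc ▸ Int.gcd_pos_of_ne_zero_right _ (by exact_mod_cast hn.ne')
  have hcn : c ∣ n := by
    have : (c : ℤ) ∣ (n : ℤ) := hc ▸ Int.gcd_dvd_right _ _
    exact_mod_cast this
  have hcx : (c : ℤ) ∣ x := hc ▸ Int.gcd_dvd_left _ _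
  obtain ⟨n', hn'⟩ : ∃ n' : ℕ, n' = n / c := ⟨_, rfl⟩
  have hnn : (c : ℤ) * n' = n := by rw [hn']; exact_mod_cast Nat.mul_div_cancel' hcn
  have hn'0 : 0 < n' := hn' ▸ Nat.div_pos (Nat.le_of_dvd hn hcn) hc0
  obtain ⟨x', hx'⟩ := hcx
  have hc0' : (c : ℤ) ≠ 0 := by exact_mod_cast hc0.ne'
  obtain ⟨u, v, huv⟩ : ∃ u v : ℤ, u * x' + v * n' = 1 := by
    have h1 := Int.gcd_eq_gcd_ab x n
    rw [← hc] at h1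
    refine ⟨Int.gcdA x n, Int.gcdB x n, mul_left_cancel₀ hc0' ?_⟩
    linear_combination -h1 - (Int.gcdA x n) * hx' + (Int.gcdB x n) * hnn
  -- a unit `ν` modulo `n` with `ν x ≡ c`
  obtain ⟨k, hk⟩ := exists_coprime_add_mul hn.ne' u n' (by
    intro p pp _ hpu hpn
    have h1 : (p : ℤ) ∣ 1 := huv ▸ dvd_add (hpu.mul_right x') (hpn.mul_left v)
    exact (Nat.prime_iff_prime_int.1 pp).not_isUnit (isUnit_of_dvd_one h1))
  obtain ⟨ν, hν⟩ : ∃ ν : ℤ, ν = u + k * n' := ⟨_, rfl⟩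
  rw [← hν] at hk
  have hνx : (n : ℤ) ∣ c - ν * x := by
    refine ⟨v - k * x', ?_⟩
    rw [hν, hx', ← hnn]
    linear_combination (-(c : ℤ)) * huv
  obtain ⟨d, hd⟩ : ∃ d : ℤ, d = ν * y := ⟨_, rfl⟩
  have hcd : IsCoprime (c : ℤ) d := by
    rw [hd]
    exact IsCoprime.mul_right (hk.of_isCoprime_of_dvd_right ⟨_, hnn.symm⟩).symm
      (hxy.of_isCoprime_of_dvd_left ⟨x', hx'⟩)
  have h1 : ProjPair.mk n x y = ProjPair.mk n c d :=
    Quotient.sound (s := projSetoid n)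
      ⟨ν, hk, Int.modEq_iff_dvd.2 hνx, by rw [hd]⟩
  -- the admissible pair
  have hn'0' : (0 : ℤ) < n' := by exact_mod_cast hn'0
  have hb0 := Int.emod_nonneg (d - c) hn'0'.ne'
  have hb1 := Int.emod_lt_of_pos (d - c) hn'0'
  have hbe := Int.mul_ediv_add_emod (d - c) n'
  obtain ⟨b, hb⟩ : ∃ b : ℕ, (b : ℤ) = (d - c) % n' := ⟨((d - c) % n').toNat, by omega⟩
  obtain ⟨t, ht⟩ : ∃ t : ℤ, t = (d - c) / n' := ⟨_, rfl⟩
  rw [← hb] at hb0 hb1 hbe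
  rw [← ht] at hbe
  have hm0 := Int.emod_nonneg t hc0'
  have hm1 := Int.emod_lt_of_pos t (by exact_mod_cast hc0 : (0 : ℤ) < c)
  have hme := Int.mul_ediv_add_emod t c
  obtain ⟨m, hm⟩ : ∃ m : ℕ, (m : ℤ) = t % c := ⟨(t % c).toNat, by omega⟩
  rw [← hm] at hm0 hm1 hme
  have hadm : Nat.gcd c (b + m * (n / c)) = 1 := by
    rw [← hn']
    change Nat.Coprime c (b + m * n')
    rw [← Nat.isCoprime_iff_coprime]
    have h2 : ((b + m * n' : ℕ) : ℤ) = d + c * (-1 - (t / c) * n') := by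
      push_cast
      linear_combination hbe + (n' : ℤ) * hme
    rw [h2]
    exact hcd.add_mul_left_right _
  let p : Admissible n :=
    ⟨(c, b), hc0, hcn, by rw [← hn']; exact_mod_cast hb1, m, by exact_mod_cast hm1, hadm⟩
  refine ⟨p, Subtype.ext ?_⟩
  change ProjPair.mk n c (dMin n c b) = (ProjPair.mk n 0 1).act g.1
  rw [hi, h1]
  symm
  -- `d` may be changed modulo `n / c`
  have hDc : IsCoprime (c : ℤ) (dMin n c b : ℤ) := dMin_coprime p
  have hDm : (dMin n c b : ℤ) ≡ c + b [ZMOD (n / c : ℕ)] := dMin_modEq p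
  rw [← hn'] at hDm
  obtain ⟨D, hD⟩ : ∃ D : ℤ, D = (dMin n c b : ℤ) := ⟨_, rfl⟩
  rw [← hD] at hDc hDm ⊢
  obtain ⟨e, he⟩ := hDm.dvd
  obtain ⟨l, hl⟩ : ∃ l : ℤ, D - d = l * n' := ⟨-e - t, by linear_combination -he + hbe⟩
  obtain ⟨β, α, hαβ⟩ := hcd
  have hkd : (1 + n' * (α * l)) * d = D - β * l * n := by
    linear_combination (n' : ℤ) * l * hαβ - hl - β * l * hnn
  refine Quotient.sound (s := projSetoid n) ⟨1 + n' * (α * l), ?_, ?_, ?_⟩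
  · rw [← hnn]
    refine IsCoprime.mul_right ?_ ?_
    · have h2 : IsCoprime ((1 + n' * (α * l)) * d) (c : ℤ) := by
        rw [hkd]
        have h3 : D - β * l * n = D + c * (-(β * l * n')) := by rw [← hnn]; ring
        rw [h3]
        exact hDc.symm.add_mul_left_left _
      exact h2.of_mul_left_left
    · exact isCoprime_one_left.add_mul_left_left _
  · refine Int.modEq_iff_dvd.2 ⟨-(α * l), ?_⟩
    rw [← hnn]; ring
  · refine Int.modEq_iff_dvd.2 ⟨β * l, ?_⟩
    linear_combination -hkd

/-- The bijection `(c, b) ↦ [c : d(c, b)]` from the `n`-admissible pairs onto `I_n`. -/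
noncomputable def paramEquiv {n : ℕ} (hn : 0 < n) : Admissible n ≃ Idx n :=
  Equiv.ofBijective (paramMap n) ⟨paramMap_injective n, paramMap_surjective hn⟩

/-- `A_i = (c b; 0 n / c)` for the pair `(c, b)` that belongs to `i`. -/
noncomputable def matA {n : ℕ} (hn : 0 < n) (i : Idx n) : Matrix (Fin 2) (Fin 2) ℤ :=
  let p := (paramEquiv hn).symm i
  !![(p.1.1 : ℤ), (p.1.2 : ℤ); 0, ((n / p.1.1 : ℕ) : ℤ)]

/-! ### The operator `K` and the chains -/

/-- `S_n`: the matrices `(a b; c d)` with `a > c ≥ 0`, `d > b ≥ 0` and `a d - b c = n`. -/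
def setS (n : ℕ) : Set (Matrix (Fin 2) (Fin 2) ℤ) :=
  {A | A 0 0 > A 1 0 ∧ A 1 0 ≥ 0 ∧ A 1 1 > A 0 1 ∧ A 0 1 ≥ 0 ∧
    A 0 0 * A 1 1 - A 0 1 * A 1 0 = n}

/-- `Y_n`: the matrices `(c 0; a n / c)` with `c ∣ n` and `0 ≤ a < c`. -/
def setY (n : ℕ) : Set (Matrix (Fin 2) (Fin 2) ℤ) :=
  {A | ∃ c a : ℕ, c ∣ n ∧ a < c ∧ A = !![(c : ℤ), 0; (a : ℤ), ((n / c : ℕ) : ℤ)]}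

/-- `K (a b; c d) = T ^ ⌈d / b⌉ Q (a b; c d)`, where `T ^ k = (1 k; 0 1)` and `Q = (0 -1; 1 0)`.
It is used for matrices in `S_n` outside `Y_n` only; for these `b > 0`. -/
def opK (A : Matrix (Fin 2) (Fin 2) ℤ) : Matrix (Fin 2) (Fin 2) ℤ :=
  !![1, ⌈(A 1 1 : ℚ) / (A 0 1 : ℚ)⌉; 0, 1] * !![0, -1; 1, 0] * A

theorem matA_mem_setS {n : ℕ} (hn : 0 < n) (i : Idx n) : matA hn i ∈ setS n := by
  have h := ((paramEquiv hn).symm i).2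
  have h' := cast_mul_div ((paramEquiv hn).symm i)
  refine ⟨?_, ?_, ?_, ?_, ?_⟩ <;> simp only [matA, Matrix.of_apply, Matrix.cons_val', 
    Matrix.cons_val_zero, Matrix.cons_val_one, Matrix.cons_val_fin_one]
  · exact_mod_cast h.1
  · exact le_rfl
  · exact_mod_cast h.2.2.1
  · positivity
  · rw [h']; ring

theorem mem_setY_of_eq_zero {n : ℕ} {A : Matrix (Fin 2) (Fin 2) ℤ} (hA : A ∈ setS n)
    (h : A 0 1 = 0) : A ∈ setY n := by
  obtain ⟨h1, h2, h3, h4, h5⟩ := hA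
  rw [h] at h3 h5
  obtain ⟨a, ha⟩ := Int.eq_ofNat_of_zero_le (h2.trans h1.le)
  obtain ⟨c, hc⟩ := Int.eq_ofNat_of_zero_le h2
  obtain ⟨d, hd⟩ := Int.eq_ofNat_of_zero_le h3.le
  have hn : a * d = n := by
    rw [ha, hd] at h5
    have : (a : ℤ) * d = n := by linarith
    exact_mod_cast this
  have ha0 : 0 < a := by omega
  refine ⟨a, c, ⟨d, hn.symm⟩, by omega, ?_⟩
  rw [← hn, Nat.mul_div_cancel_left d ha0]
  ext i j
  fin_cases i <;> fin_cases j <;> simp [ha, hc, hd, h]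

theorem opK_mem {n : ℕ} {A : Matrix (Fin 2) (Fin 2) ℤ} (hA : A ∈ setS n) (h : A 0 1 ≠ 0) :
    opK A ∈ setS n ∧ (opK A) 0 1 < A 0 1 := by
  obtain ⟨h1, h2, h3, h4, h5⟩ := hA
  have hb : 0 < A 0 1 := lt_of_le_of_ne h4 h.symm
  have hbq : (0 : ℚ) < (A 0 1 : ℚ) := by exact_mod_cast hb
  obtain ⟨k, hk⟩ : ∃ k : ℤ, k = ⌈(A 1 1 : ℚ) / (A 0 1 : ℚ)⌉ := ⟨_, rfl⟩
  have hk1 : A 1 1 ≤ k * A 0 1 := by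
    have := Int.le_ceil ((A 1 1 : ℚ) / (A 0 1 : ℚ))
    rw [← hk, div_le_iff₀ hbq] at this
    exact_mod_cast this
  have hk2 : k * A 0 1 < A 1 1 + A 0 1 := by
    have := Int.ceil_lt_add_one ((A 1 1 : ℚ) / (A 0 1 : ℚ))
    rw [← hk, ← sub_lt_iff_lt_add, lt_div_iff₀ hbq] at this
    have h' : (k - 1) * A 0 1 < A 1 1 := by exact_mod_cast this
    linarith
  have hk3 : 2 ≤ k := by nlinarith
  have e00 : (opK A) 0 0 = -A 1 0 + k * A 0 0 := by
    simp [opK, ← hk, Matrix.mul_apply, Fin.sum_univ_two]; ring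
  have e01 : (opK A) 0 1 = -A 1 1 + k * A 0 1 := by
    simp [opK, ← hk, Matrix.mul_apply, Fin.sum_univ_two]; ring
  have e10 : (opK A) 1 0 = A 0 0 := by
    simp [opK, Matrix.mul_apply, Fin.sum_univ_two]
  have e11 : (opK A) 1 1 = A 0 1 := by
    simp [opK, Matrix.mul_apply, Fin.sum_univ_two]
  refine ⟨⟨?_, ?_, ?_, ?_, ?_⟩, ?_⟩
  · rw [e00, e10]; nlinarith
  · rw [e10]; linarith
  · rw [e11, e01]; linarith
  · rw [e01]; linarith
  · rw [e00, e01, e10, e11]; linear_combination h5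
  · rw [e01]; linarith

theorem exists_iterate_mem_setY {n : ℕ} {A : Matrix (Fin 2) (Fin 2) ℤ} (hA : A ∈ setS n) :
    ∃ j : ℕ, opK^[j] A ∈ setY n := by
  by_cases h : A 0 1 = 0
  · exact ⟨0, mem_setY_of_eq_zero hA h⟩
  · obtain ⟨j, hj⟩ := exists_iterate_mem_setY (opK_mem hA h).1
    exact ⟨j + 1, hj⟩
termination_by (A 0 1).toNat
decreasing_by
  have h1 := (opK_mem hA h).2
  have h2 := (opK_mem hA h).1.2.2.2.1
  omega

open Classical in
/-- `k_i`: the chain `A_i, K A_i, K² A_i, …` stops as soon as it reaches `Y_n`, where `K` is no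
longer defined. -/
noncomputable def chainLen {n : ℕ} (hn : 0 < n) (i : Idx n) : ℕ :=
  Nat.find (exists_iterate_mem_setY (matA_mem_setS hn i))

/-! ### The ring of matrices and the slash action -/

/-- The ring of finite formal integer combinations of integer `2 × 2` matrices. -/
abbrev MatRing : Type := MonoidAlgebra ℤ (Matrix (Fin 2) (Fin 2) ℤ)

/-- `ψ̃_i = ∑_{j = 0}^{k_i} K^j (A_i)`. -/
noncomputable def psiTilde {n : ℕ} (hn : 0 < n) (i : Idx n) : MatRing :=
  ∑ j ∈ Finset.range (chainLen hn i + 1), MonoidAlgebra.single (opK^[j] (matA hn i)) (1 : ℤ)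

theorem finite_setS (n : ℕ) : (setS n).Finite := by
  have hfin : {A : Fin 2 → Fin 2 → ℤ |
      ∀ i, A i ∈ {v : Fin 2 → ℤ | ∀ j, v j ∈ Set.Icc (0 : ℤ) n}}.Finite :=
    Set.Finite.pi' fun _ => Set.Finite.pi' fun _ => Set.finite_Icc _ _
  refine hfin.subset ?_
  rintro A ⟨h1, h2, h3, h4, h5⟩
  have h6 : A 0 0 + A 1 1 ≤ n + 1 := by nlinarith
  intro i j
  fin_cases i <;> fin_cases j <;> constructor <;> simp <;> linarith

/-- The Hecke operator `T_n = ∑_{A ∈ S_n} A`. -/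
noncomputable def heckeT (n : ℕ) : MatRing :=
  ∑ A ∈ (finite_setS n).toFinset, MonoidAlgebra.single A (1 : ℤ)

/-- `T̃_n`: the sum of the matrices in `S_n` whose entries have greatest common divisor `1`. -/
noncomputable def heckeTTilde (n : ℕ) : MatRing :=
  ∑ A ∈ (finite_setS n).toFinset with
      Nat.gcd (Int.gcd (A 0 0) (A 0 1)) (Int.gcd (A 1 0) (A 1 1)) = 1,
    MonoidAlgebra.single A (1 : ℤ)

/-- `(φ |_s A) (z) = |det A| ^ s (c z + d) ^ (-2 s) φ ((a z + b) / (c z + d))` for a matrix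
`A = (a b; c d)`, with the principal branch of the power. -/
noncomputable def slashMat (s : ℂ) (φ : ℂ → ℂ) (A : Matrix (Fin 2) (Fin 2) ℤ) : ℂ → ℂ :=
  fun z => ((|A.det| : ℤ) : ℂ) ^ s * ((A 1 0 : ℂ) * z + (A 1 1 : ℂ)) ^ (-2 * s) *
    φ (((A 0 0 : ℂ) * z + (A 0 1 : ℂ)) / ((A 1 0 : ℂ) * z + (A 1 1 : ℂ)))

/-- The linear extension `φ |_s ∑ m_A A = ∑ m_A (φ |_s A)`. -/
noncomputable def slash (s : ℂ) (φ : ℂ → ℂ) (R : MatRing) : ℂ → ℂ :=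
  fun z => R.coeff.sum fun A m => (m : ℂ) * slashMat s φ A z

/-! ### The Lewis equations -/

/-- Solutions of the Lewis equation for `PSL(2, ℤ)` of weight `s` with sign `lam`: functions that
are holomorphic in `ℂ \ (-∞, 0]` with `φ(z) = φ(z + 1) + lam z ^ (-2 s) φ(1 + 1 / z)` there. -/
def IsLewisSolution (s lam : ℂ) (φ : ℂ → ℂ) : Prop :=
  DifferentiableOn ℂ φ Complex.slitPlane ∧
    ∀ z ∈ Complex.slitPlane, φ z = φ (z + 1) + lam * z ^ (-2 * s) * φ (1 + 1 / z)

/-- Solutions of the Lewis system for `Γ̄₀(n)` of weight `s` with sign `lam`: families `(φ_i)`,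
`i ∈ I_n`, of functions that are holomorphic in `ℂ \ (-∞, 0]` and satisfy there
`φ_i(z) - φ_{i T⁻¹}(z + 1) - lam z ^ (-2 s) φ_{i T⁻¹ M}(1 + 1 / z) = 0` for all `i`. -/
def IsLewisSystemSolution (n : ℕ) (s lam : ℂ) (Φ : Idx n → ℂ → ℂ) : Prop :=
  (∀ i, DifferentiableOn ℂ (Φ i) Complex.slitPlane) ∧
    ∀ i, ∀ z ∈ Complex.slitPlane,
      Φ i z - Φ (i.act matT⁻¹) (z + 1)
        - lam * z ^ (-2 * s) * Φ (i.act (matT⁻¹ * matM)) (1 + 1 / z) = 0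

/-! ### The pulled back solutions -/

theorem quot_pos {n d : ℕ} (hn : 0 < n) (hd : d ^ 2 ∣ n) : 0 < n / d ^ 2 :=
  Nat.div_pos (Nat.le_of_dvd hn hd) (Nat.pos_of_dvd_of_pos hd hn)

/-- `φ̃_{j, d} = φ |_s ψ̃_{σ(j)}` for `j ∈ I_n`, where `σ : I_n → I_{n / d²}` is the reduction. -/
noncomputable def phiTilde {n d : ℕ} (hn : 0 < n) (hd : d ^ 2 ∣ n) (s : ℂ) (φ : ℂ → ℂ)
    (j : Idx n) : ℂ → ℂ :=
  slash s φ (psiTilde (quot_pos hn hd) (sigma (Nat.div_dvd_of_dvd hd) j))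

/-- The average `(1 / μ) ∑_{j ∈ I_n} φ̃_{j, d}`, where `μ` is the index of `Γ̄₀(n)` in
`Γ̄₀(n / d²)`. -/
noncomputable def phiAverage {n d : ℕ} (hn : 0 < n) (hd : d ^ 2 ∣ n) (s : ℂ) (φ : ℂ → ℂ) :
    ℂ → ℂ :=
  haveI := finite_Idx hn
  letI := Fintype.ofFinite (Idx n)
  fun z => (1 / ((GammaBar n).relIndex (GammaBar (n / d ^ 2)) : ℂ)) *
    ∑ j : Idx n, phiTilde hn hd s φ j z

end Lewis

/-! The identity `φ|(AB) = (φ|A)|B` fails for general matrices because of the principal branches,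
but it holds on the slit plane for nonnegative matrices of nonzero determinant
(`IsNonneg.slashMat_mul`): all denominators then lie on the same side of the real axis as `z`, or on
it, so their logarithms add. Every matrix to which the action is applied below is of this kind.
Applying `M` to the Lewis equation gives `φ|M = λφ`. Since `TM = MT'` with `T' = (1 0; 1 1)`, the
equation becomes `φ = φ|T + φ|T'`, and this may be multiplied on the right by any nonnegative `B`
(`IsLewisSolution.three_term`).

To `j = [x : y]` belongs the lattice `ℤ(x, y) + nℤ²`. The operator `K` multiplies on the left by a
unimodular matrix, so it keeps the row lattice of a matrix. It can be run backwards inside `S_n`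
until the matrix is upper triangular (`exists_triangular`), and by uniqueness of the Hermite normal
form `A_i` is the only triangular element of `S_n` with rows in the lattice of `iT⁻¹` (`eq_matA`).
Hence the chain of `i` is exactly the set of all `B ∈ S_n` with rows in that lattice
(`psiTilde_eq`).

The system for the `ψ̃_i` then follows from an identity between sets. Let `P` be the set of
nonnegative matrices of determinant `n` and `X` the set of transposes of `S_n`. As formal sums, `S_n
= (1 - T - T')P` and `X = P(1 - T - T')`, hence `S_n(1 - T - T') = (1 - T - T')X`
(`indicator_setS_sub`). Left multiplication by `T`, `T'` keeps the lattice, right multiplication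
moves it by the action on `j`. Pairing with `B ↦ φ|B`, the right side vanishes by the three term
relation and the left side is the Lewis system (`sum_cosetS_three_term`).

The chains partition the matrices of `S_n` of content 1 (`sum_primS`), so `T̃_n` is the sum of all
`ψ̃_i`. The group permutes the indices, so summing the Lewis system over them gives the Lewis
equation. All fibres of the reduction have size `μ_d` (`card_fibre_sigma`), which accounts for the
average. Sorting `S_n` by content decomposes `T_n`, and scalar matrices act trivially. -/

namespace Lewis

open Complex Matrix

/-! ### The slash action of nonnegative matrices -/

/-- The integer matrices with nonnegative entries and nonzero determinant. -/
def IsNonneg (A : Matrix (Fin 2) (Fin 2) ℤ) : Prop :=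
  0 ≤ A 0 0 ∧ 0 ≤ A 0 1 ∧ 0 ≤ A 1 0 ∧ 0 ≤ A 1 1 ∧ A.det ≠ 0

theorem IsNonneg.mul {A B : Matrix (Fin 2) (Fin 2) ℤ} (hA : IsNonneg A) (hB : IsNonneg B) :
    IsNonneg (A * B) := by
  obtain ⟨h1, h2, h3, h4, h5⟩ := hA
  obtain ⟨k1, k2, k3, k4, k5⟩ := hB
  refine ⟨?_, ?_, ?_, ?_, by rw [det_mul]; exact mul_ne_zero h5 k5⟩ <;>
  · simp only [mul_apply, Fin.sum_univ_two]; positivity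

/-- The denominator `c z + d`. -/
noncomputable def denom (A : Matrix (Fin 2) (Fin 2) ℤ) (z : ℂ) : ℂ :=
  (A 1 0 : ℂ) * z + (A 1 1 : ℂ)

/-- The fractional linear action `(a z + b) / (c z + d)`. -/
noncomputable def moebius (A : Matrix (Fin 2) (Fin 2) ℤ) (z : ℂ) : ℂ :=
  ((A 0 0 : ℂ) * z + (A 0 1 : ℂ)) / denom A z

theorem slashMat_eq (s : ℂ) (φ : ℂ → ℂ) (A : Matrix (Fin 2) (Fin 2) ℤ) (z : ℂ) :
    slashMat s φ A z = ((|A.det| : ℤ) : ℂ) ^ s * denom A z ^ (-2 * s) * φ (moebius A z) := rfl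

theorem linear_mem_slitPlane {p q : ℤ} (hp : 0 ≤ p) (hq : 0 ≤ q) (h : p ≠ 0 ∨ q ≠ 0) {z : ℂ}
    (hz : z ∈ slitPlane) : (p : ℂ) * z + q ∈ slitPlane := by
  have hp' : (0 : ℝ) ≤ p := by exact_mod_cast hp
  have hq' : (0 : ℝ) ≤ q := by exact_mod_cast hq
  rw [mem_slitPlane_iff] at hz ⊢
  simp only [add_re, mul_re, intCast_re, intCast_im, zero_mul, sub_zero, add_im, mul_im, add_zero]
  by_cases h0 : p = 0
  · subst h0
    have : 0 < q := lt_of_le_of_ne hq (by tauto)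
    left
    simpa using this
  · have hp0 : (0 : ℝ) < p := by exact_mod_cast lt_of_le_of_ne hp (Ne.symm h0)
    rcases hz with hz | hz
    · left; positivity
    · right; exact mul_ne_zero hp0.ne' hz

theorem IsNonneg.denom_mem {A : Matrix (Fin 2) (Fin 2) ℤ} (hA : IsNonneg A) {z : ℂ}
    (hz : z ∈ slitPlane) : denom A z ∈ slitPlane := by
  refine linear_mem_slitPlane hA.2.2.1 hA.2.2.2.1 ?_ hz
  by_contra! h
  exact hA.2.2.2.2 (by rw [det_fin_two, h.1, h.2]; ring)

theorem IsNonneg.num_mem {A : Matrix (Fin 2) (Fin 2) ℤ} (hA : IsNonneg A) {z : ℂ}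
    (hz : z ∈ slitPlane) : (A 0 0 : ℂ) * z + (A 0 1 : ℂ) ∈ slitPlane := by
  refine linear_mem_slitPlane hA.1 hA.2.1 ?_ hz
  by_contra! h
  exact hA.2.2.2.2 (by rw [det_fin_two, h.1, h.2]; ring)

/-- The imaginary part of the image is `det A · Im z / |cz + d|²`, so nonreal points stay nonreal. A
real point of the slit plane is positive, and there numerator and denominator are both positive. -/
theorem IsNonneg.moebius_mem {A : Matrix (Fin 2) (Fin 2) ℤ} (hA : IsNonneg A) {z : ℂ}
    (hz : z ∈ slitPlane) : moebius A z ∈ slitPlane := by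
  have hv := hA.denom_mem hz
  have hu := hA.num_mem hz
  have hv0 := slitPlane_ne_zero hv
  unfold moebius
  have hn : 0 < normSq (denom A z) := normSq_pos.2 hv0
  rw [mem_slitPlane_iff]
  by_cases him : z.im = 0
  · left
    have hu0 : ((A 0 0 : ℂ) * z + (A 0 1 : ℂ)).im = 0 := by simp [him]
    have hv1 : (denom A z).im = 0 := by simp [denom, him]
    rw [mem_slitPlane_iff, hu0] at hu
    rw [mem_slitPlane_iff, hv1] at hv
    have hu2 := hu.resolve_right (by simp)
    have hv2 := hv.resolve_right (by simp)
    rw [div_re, hu0, zero_mul, zero_div, add_zero]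
    positivity
  · right
    have : (((A 0 0 : ℂ) * z + (A 0 1 : ℂ)) / denom A z).im =
        A.det * z.im / normSq (denom A z) := by
      rw [div_im, ← sub_div, det_fin_two]
      congr 1
      simp [denom]
      ring
    rw [this]
    have hd : (A.det : ℝ) ≠ 0 := by exact_mod_cast hA.2.2.2.2
    positivity

theorem moebius_mul_denom {B : Matrix (Fin 2) (Fin 2) ℤ} {z : ℂ} (h : denom B z ≠ 0) :
    moebius B z * denom B z = (B 0 0 : ℂ) * z + (B 0 1 : ℂ) :=
  div_mul_cancel₀ _ h

theorem denom_mul {A B : Matrix (Fin 2) (Fin 2) ℤ} {z : ℂ} (h : denom B z ≠ 0) :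
    denom (A * B) z = denom A (moebius B z) * denom B z := by
  have key := moebius_mul_denom h
  rw [denom, denom, add_mul, mul_assoc, key, denom]
  simp only [mul_apply, Fin.sum_univ_two]
  push_cast
  ring

theorem moebius_mul {A B : Matrix (Fin 2) (Fin 2) ℤ} {z : ℂ} (h : denom B z ≠ 0)
    (h' : denom A (moebius B z) ≠ 0) :
    moebius (A * B) z = moebius A (moebius B z) := by
  have key := moebius_mul_denom h
  have h1 := moebius_mul_denom h'
  have h2 : denom (A * B) z ≠ 0 := by rw [denom_mul h]; exact mul_ne_zero h' h
  refine mul_right_cancel₀ h2 ?_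
  rw [moebius_mul_denom h2, denom_mul h, ← mul_assoc, h1, add_mul, mul_assoc, key, denom]
  simp only [mul_apply, Fin.sum_univ_two]
  push_cast
  ring

/-! ### Additivity of the logarithm and the cocycle relation for the automorphy factor -/

/-- If `arg u + arg v` left `(-π, π]`, both arguments would have the same sign, while the sine of
their sum, hence `Im (uv)`, would have the opposite one. The two sign hypotheses forbid this. -/
theorem log_mul_of_im {u v : ℂ} (hu : u ∈ slitPlane) (hv : v ∈ slitPlane)
    (huv : u * v ∈ slitPlane)
    (hpos : 0 ≤ u.im → 0 ≤ v.im → 0 ≤ (u * v).im)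
    (hneg : u.im ≤ 0 → v.im ≤ 0 → (u * v).im ≤ 0) :
    log (u * v) = log u + log v := by
  have hu0 := slitPlane_ne_zero hu
  have hv0 := slitPlane_ne_zero hv
  have hpi := Real.pi_pos
  have hsin : (u * v).im = ‖u‖ * ‖v‖ * Real.sin (u.arg + v.arg) := by
    rw [Real.sin_add, mul_im]
    linear_combination (-v.im) * norm_mul_cos_arg u - ‖u‖ * Real.cos u.arg * norm_mul_sin_arg v
      - v.re * norm_mul_sin_arg u - ‖u‖ * Real.sin u.arg * norm_mul_cos_arg v
  have hcos : (u * v).re = ‖u‖ * ‖v‖ * Real.cos (u.arg + v.arg) := by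
    rw [Real.cos_add, mul_re]
    linear_combination (-v.re) * norm_mul_cos_arg u - ‖u‖ * Real.cos u.arg * norm_mul_cos_arg v
      + v.im * norm_mul_sin_arg u + ‖u‖ * Real.sin u.arg * norm_mul_sin_arg v
  have hnn : 0 < ‖u‖ * ‖v‖ := by positivity
  have hun := neg_pi_lt_arg u
  have hvn := neg_pi_lt_arg v
  have hup := lt_of_le_of_ne (arg_le_pi u) (mem_slitPlane_iff_arg.1 hu).1
  have hvp := lt_of_le_of_ne (arg_le_pi v) (mem_slitPlane_iff_arg.1 hv).1
  refine log_mul hu0 hv0 ⟨?_, ?_⟩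
  · by_contra! h
    have h3 := hneg (arg_neg_iff.1 (by linarith)).le (arg_neg_iff.1 (by linarith)).le
    rw [hsin] at h3
    -- At the endpoint `-π` the sine vanishes and gives no contradiction; there the product is a
    -- negative real and so outside the slit plane.
    rcases h.lt_or_eq with h | h
    · have h4 : 0 < Real.sin (u.arg + v.arg) := by
        rw [← Real.sin_add_two_pi]
        exact Real.sin_pos_of_pos_of_lt_pi (by linarith) (by linarith)
      nlinarith
    · rw [mem_slitPlane_iff, hsin, hcos, h] at huv
      simp at huv
      exact absurd (mul_pos (norm_pos_iff.2 hu0) (norm_pos_iff.2 hv0)) (by linarith)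
  · by_contra! h
    have h3 := hpos (arg_nonneg_iff.1 (by linarith)) (arg_nonneg_iff.1 (by linarith))
    rw [hsin] at h3
    have h4 : Real.sin (u.arg + v.arg) < 0 := by
      rw [← Real.sin_sub_two_pi]
      exact Real.sin_neg_of_neg_of_neg_pi_lt (by linarith) (by linarith)
    nlinarith

theorem IsNonneg.denom_mul_cpow {A B : Matrix (Fin 2) (Fin 2) ℤ} (hA : IsNonneg A)
    (hB : IsNonneg B) {z : ℂ} (hz : z ∈ slitPlane) (w : ℂ) :
    denom (A * B) z ^ w = denom A (moebius B z) ^ w * denom B z ^ w := by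
  have hv := hB.denom_mem hz
  have hu := hA.denom_mem (hB.moebius_mem hz)
  have huv := (hA.mul hB).denom_mem hz
  have hmul := denom_mul (A := A) (slitPlane_ne_zero hv)
  have him : ∀ C : Matrix (Fin 2) (Fin 2) ℤ, (denom C z).im = C 1 0 * z.im := by
    intro C; simp [denom]
  have hc : (0 : ℝ) ≤ B 1 0 := by exact_mod_cast hB.2.2.1
  have hc' : (0 : ℝ) ≤ (A * B) 1 0 := by exact_mod_cast (hA.mul hB).2.2.1
  -- If `B` has lower left entry `0`, its denominator is real and its sign says nothing about `Im
  -- z`; the sign of the product must then be read off from the other factor.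
  have hc0 : (B 1 0 : ℝ) = 0 → ((A * B) 1 0 : ℝ) * z.im = (B 1 1 : ℝ) * (denom A (moebius B z)).im := by
    intro h0
    have h1 : (denom B z).im = 0 := by rw [him, h0, zero_mul]
    rw [← him, hmul, mul_im, h1, mul_zero, zero_add]
    have h0' : B 1 0 = 0 := by exact_mod_cast h0
    simp [denom, h0', mul_comm]
  have hd : (0 : ℝ) ≤ B 1 1 := by exact_mod_cast hB.2.2.2.1
  have hlog : log (denom (A * B) z) = log (denom A (moebius B z)) + log (denom B z) := by
    have e : (denom A (moebius B z) * denom B z).im = (A * B) 1 0 * z.im := by rw [← hmul, him]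
    rw [hmul] at huv ⊢
    refine log_mul_of_im hu hv huv (fun h1 h2 => ?_) (fun h1 h2 => ?_)
    · rw [e]
      rw [him] at h2
      rcases le_or_gt 0 z.im with ht | ht
      · positivity
      · rw [hc0 (by nlinarith)]
        positivity
    · rw [e]
      rw [him] at h2
      rcases le_or_gt z.im 0 with ht | ht
      · exact mul_nonpos_of_nonneg_of_nonpos hc' ht
      · rw [hc0 (by nlinarith)]
        exact mul_nonpos_of_nonneg_of_nonpos hd h1
  rw [cpow_def_of_ne_zero (slitPlane_ne_zero huv), cpow_def_of_ne_zero (slitPlane_ne_zero hu),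
    cpow_def_of_ne_zero (slitPlane_ne_zero hv), ← Complex.exp_add, hlog, add_mul]

theorem IsNonneg.slashMat_mul {A B : Matrix (Fin 2) (Fin 2) ℤ} (hA : IsNonneg A)
    (hB : IsNonneg B) {z : ℂ} (hz : z ∈ slitPlane) (s : ℂ) (φ : ℂ → ℂ) :
    slashMat s φ (A * B) z = slashMat s (slashMat s φ A) B z := by
  have hv := slitPlane_ne_zero (hB.denom_mem hz)
  have hu := slitPlane_ne_zero (hA.denom_mem (hB.moebius_mem hz))
  have hdet : ((|(A * B).det| : ℤ) : ℂ) ^ s = ((|A.det| : ℤ) : ℂ) ^ s * ((|B.det| : ℤ) : ℂ) ^ s := by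
    rw [det_mul, abs_mul, Int.abs_eq_natAbs, Int.abs_eq_natAbs, Int.cast_mul, Int.cast_natCast,
      Int.cast_natCast, natCast_mul_natCast_cpow]
  rw [slashMat_eq, slashMat_eq, slashMat_eq, hdet, hA.denom_mul_cpow hB hz, moebius_mul hv hu]
  ring

theorem slashMat_congr {s : ℂ} {φ ψ : ℂ → ℂ} (h : ∀ z ∈ slitPlane, φ z = ψ z)
    {A : Matrix (Fin 2) (Fin 2) ℤ} (hA : IsNonneg A) {z : ℂ} (hz : z ∈ slitPlane) :
    slashMat s φ A z = slashMat s ψ A z := by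
  rw [slashMat_eq, slashMat_eq, h _ (hA.moebius_mem hz)]

theorem differentiableOn_slashMat {s : ℂ} {φ : ℂ → ℂ} (hφ : DifferentiableOn ℂ φ slitPlane)
    {A : Matrix (Fin 2) (Fin 2) ℤ} (hA : IsNonneg A) :
    DifferentiableOn ℂ (slashMat s φ A) slitPlane := by
  have hden : DifferentiableOn ℂ (denom A) slitPlane := by unfold denom; fun_prop
  have hmoe : DifferentiableOn ℂ (moebius A) slitPlane := by
    refine DifferentiableOn.div (by fun_prop) hden fun z hz => slitPlane_ne_zero (hA.denom_mem hz)
  have h1 : DifferentiableOn ℂ (fun z => denom A z ^ (-2 * s)) slitPlane :=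
    hden.cpow_const fun z hz => hA.denom_mem hz
  exact (h1.const_mul _).mul (hφ.comp hmoe fun z hz => hA.moebius_mem hz)

theorem slash_sum_single {ι : Type*} (s : ℂ) (φ : ℂ → ℂ) (t : Finset ι)
    (f : ι → Matrix (Fin 2) (Fin 2) ℤ) (z : ℂ) :
    slash s φ (∑ i ∈ t, MonoidAlgebra.single (f i) (1 : ℤ)) z = ∑ i ∈ t, slashMat s φ (f i) z := by
  unfold slash
  rw [MonoidAlgebra.coeff_sum,
    ← Finsupp.sum_finsetSum_index (by simp) (by intros; push_cast; ring)]
  refine Finset.sum_congr rfl fun i _ => ?_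
  rw [MonoidAlgebra.coeff_single, Finsupp.sum_single_index (by simp)]
  simp

end Lewis

namespace Lewis

open Matrix

/-! ### The lattice attached to an element of `I_n` -/

/-- Both rows of `B` are multiples of `(x, y)` modulo `n`, where `j = [x : y]`. -/
def ProjPair.Mem {n : ℕ} (j : ProjPair n) (B : Matrix (Fin 2) (Fin 2) ℤ) : Prop :=
  Quotient.lift (s := projSetoid n)
    (fun q : ℤ × ℤ => ∀ r, ∃ k : ℤ, B r 0 ≡ k * q.1 [ZMOD n] ∧ B r 1 ≡ k * q.2 [ZMOD n])
    (by
      have key : ∀ p q : ℤ × ℤ, projRel n p q →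
          (∀ r, ∃ k : ℤ, B r 0 ≡ k * q.1 [ZMOD n] ∧ B r 1 ≡ k * q.2 [ZMOD n]) →
          ∀ r, ∃ k : ℤ, B r 0 ≡ k * p.1 [ZMOD n] ∧ B r 1 ≡ k * p.2 [ZMOD n] := by
        rintro p q ⟨l, -, h1, h2⟩ h r
        obtain ⟨k, hk1, hk2⟩ := h r
        refine ⟨k * l, ?_, ?_⟩
        · rw [mul_assoc]; exact hk1.trans (h1.symm.mul_left k)
        · rw [mul_assoc]; exact hk2.trans (h2.symm.mul_left k)
      exact fun p q h => propext ⟨key q p (projRel_symm h), key p q h⟩) j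

theorem mem_mk {n : ℕ} {x y : ℤ} {B : Matrix (Fin 2) (Fin 2) ℤ} :
    (ProjPair.mk n x y).Mem B ↔
      ∀ r, ∃ k : ℤ, B r 0 ≡ k * x [ZMOD n] ∧ B r 1 ≡ k * y [ZMOD n] := Iff.rfl

theorem ProjPair.Mem.mul_right {n : ℕ} {j : ProjPair n} {B : Matrix (Fin 2) (Fin 2) ℤ}
    (h : j.Mem B) (g : Matrix (Fin 2) (Fin 2) ℤ) : (j.act g).Mem (B * g) := by
  induction j using Quotient.inductionOn with
  | h q =>
    intro r
    obtain ⟨k, h1, h2⟩ := h r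
    refine ⟨k, ?_, ?_⟩
    · have := (h1.mul_right (g 0 0)).add (h2.mul_right (g 1 0))
      simp only [mul_apply, Fin.sum_univ_two]
      convert this using 1
      ring
    · have := (h1.mul_right (g 0 1)).add (h2.mul_right (g 1 1))
      simp only [mul_apply, Fin.sum_univ_two]
      convert this using 1
      ring

theorem ProjPair.act_one {n : ℕ} (j : ProjPair n) : j.act 1 = j := by
  induction j using Quotient.inductionOn with
  | h q =>
    refine congrArg (Quotient.mk (projSetoid n)) (Prod.ext ?_ ?_) <;> simp

theorem mem_act_iff {n : ℕ} (j : ProjPair n) (B : Matrix (Fin 2) (Fin 2) ℤ) (g : GL (Fin 2) ℤ) :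
    (j.act g.1).Mem (B * g.1) ↔ j.Mem B := by
  refine ⟨fun h => ?_, fun h => h.mul_right _⟩
  have := h.mul_right g⁻¹.1
  rwa [ProjPair.act_act, mul_assoc, ← Units.val_mul, mul_inv_cancel, Units.val_one, mul_one,
    ProjPair.act_one] at this

theorem ProjPair.Mem.mul_left {n : ℕ} {j : ProjPair n} {B : Matrix (Fin 2) (Fin 2) ℤ}
    (h : j.Mem B) (C : Matrix (Fin 2) (Fin 2) ℤ) : j.Mem (C * B) := by
  induction j using Quotient.inductionOn with
  | h q =>
    intro r
    obtain ⟨k, h1, h2⟩ := h 0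
    obtain ⟨l, h3, h4⟩ := h 1
    refine ⟨C r 0 * k + C r 1 * l, ?_, ?_⟩
    · have := (h1.mul_left (C r 0)).add (h3.mul_left (C r 1))
      simp only [mul_apply, Fin.sum_univ_two]
      convert this using 1
      ring
    · have := (h2.mul_left (C r 0)).add (h4.mul_left (C r 1))
      simp only [mul_apply, Fin.sum_univ_two]
      convert this using 1
      ring

theorem mem_mul_left_iff {n : ℕ} (j : ProjPair n) (B : Matrix (Fin 2) (Fin 2) ℤ)
    (g : GL (Fin 2) ℤ) : j.Mem (g.1 * B) ↔ j.Mem B := by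
  refine ⟨fun h => ?_, fun h => h.mul_left _⟩
  have := h.mul_left g⁻¹.1
  rwa [← mul_assoc, ← Units.val_mul, inv_mul_cancel, Units.val_one, one_mul] at this

/-! ### The chains -/

/-- The matrix `T ^ k Q = (k -1; 1 0)`. -/
def matTQ (k : ℤ) : GL (Fin 2) ℤ where
  val := !![k, -1; 1, 0]
  inv := !![0, 1; -1, k]
  val_inv := by
    ext i j; fin_cases i <;> fin_cases j <;> simp [mul_apply, Fin.sum_univ_two]
  inv_val := by
    ext i j; fin_cases i <;> fin_cases j <;> simp [mul_apply, Fin.sum_univ_two]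

/-- Only the unimodularity of the left factor matters later: it makes the row lattice and the
content invariant along a chain. -/
theorem opK_eq (A : Matrix (Fin 2) (Fin 2) ℤ) :
    opK A = (matTQ ⌈(A 1 1 : ℚ) / (A 0 1 : ℚ)⌉).1 * A := by
  unfold opK matTQ
  congr 1
  ext i j; fin_cases i <;> fin_cases j <;> simp [mul_apply, Fin.sum_univ_two]

theorem mem_opK_iff {n : ℕ} (j : ProjPair n) (A : Matrix (Fin 2) (Fin 2) ℤ) :
    j.Mem (opK A) ↔ j.Mem A := by
  rw [opK_eq, mem_mul_left_iff]

theorem mem_iterate_opK_iff {n : ℕ} (j : ProjPair n) (A : Matrix (Fin 2) (Fin 2) ℤ) (t : ℕ) :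
    j.Mem (opK^[t] A) ↔ j.Mem A := by
  induction t with
  | zero => rfl
  | succ t ih => rw [Function.iterate_succ_apply', mem_opK_iff, ih]

/-- One step backwards in a chain: `B' = (T ^ k Q)⁻¹ B`, where `k = ⌈a / c⌉` is forced by `0 ≤ ka' -
c' < a'` for the first column `(a', c')` of `B'`, reindexed as `0 ≤ kc - a < c`. -/
theorem exists_opK_eq {n : ℕ} {B : Matrix (Fin 2) (Fin 2) ℤ} (hB : B ∈ setS n) (h : B 1 0 ≠ 0) :
    ∃ B' ∈ setS n, opK B' = B ∧ B' 1 0 < B 1 0 ∧ B' 0 1 ≠ 0 := by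
  obtain ⟨h1, h2, h3, h4, h5⟩ := hB
  have hc : 0 < B 1 0 := lt_of_le_of_ne h2 h.symm
  have hd : 0 < B 1 1 := by omega
  obtain ⟨k, hk⟩ : ∃ k : ℤ, k = ⌈(B 0 0 : ℚ) / (B 1 0 : ℚ)⌉ := ⟨_, rfl⟩
  have hcq : (0 : ℚ) < (B 1 0 : ℚ) := by exact_mod_cast hc
  have hdq : (0 : ℚ) < (B 1 1 : ℚ) := by exact_mod_cast hd
  have hk1 : B 0 0 ≤ k * B 1 0 := by
    have := Int.le_ceil ((B 0 0 : ℚ) / (B 1 0 : ℚ))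
    rw [← hk, div_le_iff₀ hcq] at this
    exact_mod_cast this
  have hk2 : k * B 1 0 < B 0 0 + B 1 0 := by
    have := Int.ceil_lt_add_one ((B 0 0 : ℚ) / (B 1 0 : ℚ))
    rw [← hk, ← sub_lt_iff_lt_add, lt_div_iff₀ hcq] at this
    have h' : (k - 1) * B 1 0 < B 0 0 := by exact_mod_cast this
    linarith
  have hk3 : 2 ≤ k := by nlinarith
  -- `K` computes its exponent from the second column, the inverse step from the first; they agree
  -- because `0 ≤ b < d`.
  have hceil : ⌈((k * B 1 1 - B 0 1 : ℤ) : ℚ) / (B 1 1 : ℚ)⌉ = k := by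
    rw [Int.ceil_eq_iff, lt_div_iff₀ hdq, div_le_iff₀ hdq]
    constructor
    · exact_mod_cast (by nlinarith : (k - 1) * B 1 1 < k * B 1 1 - B 0 1)
    · exact_mod_cast (by linarith : k * B 1 1 - B 0 1 ≤ k * B 1 1)
  refine ⟨!![B 1 0, B 1 1; k * B 1 0 - B 0 0, k * B 1 1 - B 0 1], ⟨?_, ?_, ?_, ?_, ?_⟩, ?_, ?_, ?_⟩
  · simp; linarith
  · simp; linarith
  · simp; nlinarith
  · simp; linarith
  · simp; linarith
  · rw [opK_eq]
    simp only [of_apply, cons_val', cons_val_zero, cons_val_one, cons_val_fin_one]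
    rw [hceil]
    ext i j; fin_cases i <;> fin_cases j <;> simp [matTQ, mul_apply, Fin.sum_univ_two]
  · simp; linarith
  · simpa using hd.ne'

theorem exists_triangular {n : ℕ} {B : Matrix (Fin 2) (Fin 2) ℤ} (hB : B ∈ setS n) :
    ∃ B' ∈ setS n, B' 1 0 = 0 ∧ ∃ t, opK^[t] B' = B ∧ ∀ r < t, (opK^[r] B') 0 1 ≠ 0 := by
  by_cases h : B 1 0 = 0
  · exact ⟨B, hB, h, 0, rfl, by simp⟩
  · obtain ⟨C, hC, hCB, hlt, hne⟩ := exists_opK_eq hB h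
    obtain ⟨B', hB', h0, t, ht, hr⟩ := exists_triangular hC
    refine ⟨B', hB', h0, t + 1, by rw [Function.iterate_succ_apply', ht, hCB], fun r hr' => ?_⟩
    rcases Nat.lt_succ_iff_lt_or_eq.1 hr' with h' | rfl
    · exact hr r h'
    · rwa [ht]
termination_by (B 1 0).toNat
decreasing_by
  have h2 := hC.2.1
  omega

/-! ### Upper triangular matrices -/

/-- Applying `T⁻¹` removes the summand `c` from `d(c, b)`. What remains is congruent to `b` modulo
`n / c`, which is why the lattice of `iT⁻¹`, not that of `i`, contains the rows of `A_i`. -/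
theorem act_matT_inv_val {n : ℕ} (hn : 0 < n) (i : Idx n) :
    (i.act matT⁻¹).1 = ProjPair.mk n ((paramEquiv hn).symm i).1.1
      (dMin n ((paramEquiv hn).symm i).1.1 ((paramEquiv hn).symm i).1.2 -
        ((paramEquiv hn).symm i).1.1) := by
  obtain ⟨p, rfl⟩ := (paramEquiv hn).surjective i
  rw [Equiv.symm_apply_apply]
  refine congrArg (Quotient.mk (projSetoid n)) (Prod.ext ?_ ?_)
  · simp [matT, Units.inv_mk]
  · simp [matT, Units.inv_mk]; ring

theorem mem_matA {n : ℕ} (hn : 0 < n) (i : Idx n) : (i.act matT⁻¹).1.Mem (matA hn i) := by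
  rw [act_matT_inv_val hn, mem_mk]
  unfold matA
  obtain ⟨p, hp⟩ : ∃ p, p = (paramEquiv hn).symm i := ⟨_, rfl⟩
  simp only [← hp]
  have hcn := cast_mul_div p
  obtain ⟨q, hq⟩ := Int.modEq_iff_dvd.1 (dMin_modEq p)
  obtain ⟨u, v, huv⟩ := dMin_coprime p
  obtain ⟨D, hD⟩ : ∃ D : ℤ, D = dMin n p.1.1 p.1.2 := ⟨_, rfl⟩
  obtain ⟨c, hc⟩ : ∃ c : ℤ, c = p.1.1 := ⟨_, rfl⟩
  obtain ⟨m, hm⟩ : ∃ m : ℤ, m = (n / p.1.1 : ℕ) := ⟨_, rfl⟩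
  rw [← hc, ← hD] at huv
  rw [← hm, ← hD, ← hc] at hq
  rw [← hm, ← hc] at hcn
  rw [← hc, ← hm, ← hD]
  intro r
  fin_cases r
  -- With `m = n / c` and `uc + vD = 1`, the multiple `vm (c, D - c)` is congruent to `(0, m)`.
  -- Since `b = D - c + qm`, the first row is the generator plus `q` times this vector.
  · refine ⟨1 + q * v * m, Int.modEq_iff_dvd.2 ⟨q * v, ?_⟩, Int.modEq_iff_dvd.2 ⟨-(q * (u + v)), ?_⟩⟩
    · simp; rw [← hcn]; ring
    · simp; rw [← hcn]; linear_combination -hq + q * m * huv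
  · refine ⟨v * m, Int.modEq_iff_dvd.2 ⟨v, ?_⟩, Int.modEq_iff_dvd.2 ⟨-(u + v), ?_⟩⟩
    · simp; rw [← hcn]; ring
    · simp; rw [← hcn]; linear_combination m * huv

/-- Uniqueness of the Hermite normal form: the lattice forces `c` and `n / c` to divide the diagonal
entries, the determinant turns this into equality, and the remaining entry is known modulo `n / c`
and lies in `[0, n / c)`. -/
theorem eq_matA {n : ℕ} (hn : 0 < n) {i : Idx n} {B : Matrix (Fin 2) (Fin 2) ℤ}
    (hB : B ∈ setS n) (h0 : B 1 0 = 0) (h : (i.act matT⁻¹).1.Mem B) : B = matA hn i := by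
  rw [act_matT_inv_val hn, mem_mk] at h
  unfold matA
  obtain ⟨p, hp⟩ : ∃ p, p = (paramEquiv hn).symm i := ⟨_, rfl⟩
  simp only [← hp] at h ⊢
  obtain ⟨h1, h2, h3, h4, h5⟩ := hB
  have hb := p.2.2.2.1
  have hc1 := p.2.1
  have hcn := cast_mul_div p
  have hdm := dMin_modEq p
  obtain ⟨D, hD⟩ : ∃ D : ℤ, D = dMin n p.1.1 p.1.2 := ⟨_, rfl⟩
  obtain ⟨c, hc⟩ : ∃ c : ℤ, c = p.1.1 := ⟨_, rfl⟩
  obtain ⟨b, hb'⟩ : ∃ b : ℤ, b = p.1.2 := ⟨_, rfl⟩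
  obtain ⟨m, hm⟩ : ∃ m : ℤ, m = (n / p.1.1 : ℕ) := ⟨_, rfl⟩
  have hbm : b < m := by rw [hb', hm]; exact_mod_cast hb
  have hb0 : 0 ≤ b := by rw [hb']; positivity
  have hc0 : 0 < c := by rw [hc]; exact_mod_cast hc1
  rw [← hm, ← hD, ← hc, ← hb'] at hdm
  rw [← hm, ← hc] at hcn
  rw [← hc, ← hm, ← hb']
  rw [← hc, ← hD] at h
  have hm0 : 0 < m := by linarith
  obtain ⟨k, hk1, hk2⟩ := h 0
  obtain ⟨l, hl1, hl2⟩ := h 1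
  have hca : c ∣ B 0 0 := by
    have := (Int.modEq_iff_dvd.1 hk1)
    rw [← hcn] at this
    exact (dvd_sub_right (dvd_mul_left _ _)).1 ((dvd_mul_right _ _).trans this)
  have hml : m ∣ l := by
    rw [h0] at hl1
    have := (Int.modEq_iff_dvd.1 hl1)
    rw [← hcn, sub_zero, mul_comm l] at this
    exact (mul_dvd_mul_iff_left hc0.ne').1 this
  have hmd : m ∣ B 1 1 := by
    have := (Int.modEq_iff_dvd.1 hl2)
    rw [← hcn] at this
    exact (dvd_sub_right (hml.mul_right _)).1 ((dvd_mul_left _ _).trans this)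
  obtain ⟨a', ha'⟩ := hca
  obtain ⟨d', hd'⟩ := hmd
  have ha'0 : 0 < a' := by
    have : 0 < c * a' := by linarith
    exact pos_of_mul_pos_right this hc0.le
  have hd'0 : 0 < d' := by
    have : 0 < m * d' := by linarith
    exact pos_of_mul_pos_right this hm0.le
  have had : a' * d' = 1 := by
    rw [h0, ha', hd', ← hcn] at h5
    refine mul_left_cancel₀ (mul_pos hc0 hm0).ne' ?_
    linear_combination h5
  have ha1 : a' = 1 := Int.eq_one_of_mul_eq_one_right ha'0.le had
  have hd1 : d' = 1 := Int.eq_one_of_mul_eq_one_left hd'0.le had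
  rw [ha1, mul_one] at ha'
  rw [hd1, mul_one] at hd'
  have hkm : k ≡ 1 [ZMOD m] := by
    rw [ha'] at hk1
    have := (Int.modEq_iff_dvd.1 hk1.symm)
    rw [← hcn] at this
    have e : c * m ∣ c * (1 - k) := by
      have e' : c * (1 - k) = c - k * c := by ring
      rwa [e']
    exact Int.modEq_iff_dvd.2 ((mul_dvd_mul_iff_left hc0.ne').1 e)
  have hbb : B 0 1 ≡ b [ZMOD m] := by
    have e1 := hk2.of_dvd (⟨c, by rw [← hcn]; ring⟩ : m ∣ (n : ℤ))
    have e2 := hkm.mul_right (D - c)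
    have e3 := (hdm.sub_right c)
    refine (e1.trans e2).trans ?_
    rw [one_mul]
    convert e3 using 1
    ring
  have hB01 : B 0 1 = b := by
    have := hbb
    rwa [Int.ModEq, Int.emod_eq_of_lt h4 (by linarith), Int.emod_eq_of_lt hb0 hbm] at this
  ext r t
  fin_cases r <;> fin_cases t <;> simp [ha', hd', h0, hB01]

/-! ### `ψ̃_i` as a sum over a coset -/

-- Inside `S_n` a vanishing upper right entry already means membership in `Y_n`, so minimality of
-- the chain length keeps `K` within its domain.
open Classical in
theorem apply_ne_zero_of_lt_chainLen {n : ℕ} (hn : 0 < n) (i : Idx n) {t : ℕ}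
    (ht : t < chainLen hn i) (hS : opK^[t] (matA hn i) ∈ setS n) :
    (opK^[t] (matA hn i)) 0 1 ≠ 0 := fun h =>
  Nat.find_min (exists_iterate_mem_setY (matA_mem_setS hn i)) ht (mem_setY_of_eq_zero hS h)

theorem iterate_opK_mem_setS {n : ℕ} (hn : 0 < n) (i : Idx n) {t : ℕ} (ht : t ≤ chainLen hn i) :
    opK^[t] (matA hn i) ∈ setS n := by
  induction t with
  | zero => exact matA_mem_setS hn i
  | succ t ih =>
    have h := ih (by omega)
    rw [Function.iterate_succ_apply']
    exact (opK_mem h (apply_ne_zero_of_lt_chainLen hn i (by omega) h)).1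

theorem iterate_opK_lt {n : ℕ} (hn : 0 < n) (i : Idx n) {t u : ℕ} (htu : t < u)
    (hu : u ≤ chainLen hn i) :
    (opK^[u] (matA hn i)) 0 1 < (opK^[t] (matA hn i)) 0 1 := by
  induction u with
  | zero => omega
  | succ u ih =>
    have h := iterate_opK_mem_setS hn i (t := u) (by omega)
    have h1 := (opK_mem h (apply_ne_zero_of_lt_chainLen hn i (by omega) h)).2
    rw [Function.iterate_succ_apply']
    rcases Nat.lt_succ_iff_lt_or_eq.1 htu with h2 | rfl
    · exact h1.trans (ih h2 (by omega))
    · exact h1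

theorem zero_one_eq_zero_of_mem_setY {n : ℕ} {A : Matrix (Fin 2) (Fin 2) ℤ} (hA : A ∈ setY n) :
    A 0 1 = 0 := by
  obtain ⟨c, a, -, -, rfl⟩ := hA
  simp

open Classical in
/-- The matrices in `S_n` whose rows lie in the lattice of `j`. -/
noncomputable def cosetS {n : ℕ} (j : ProjPair n) : Finset (Matrix (Fin 2) (Fin 2) ℤ) :=
  (finite_setS n).toFinset.filter fun B => j.Mem B

theorem mem_cosetS {n : ℕ} {j : ProjPair n} {B : Matrix (Fin 2) (Fin 2) ℤ} :
    B ∈ cosetS j ↔ B ∈ setS n ∧ j.Mem B := by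
  simp [cosetS]

theorem iterate_chainLen_mem_setY {n : ℕ} (hn : 0 < n) (i : Idx n) :
    opK^[chainLen hn i] (matA hn i) ∈ setY n := by
  classical
  exact Nat.find_spec (exists_iterate_mem_setY (matA_mem_setS hn i))

/-- The triangular ancestor of `B` has the same row lattice, hence is `A_i`. The path down to `B`
meets no zero upper right entry before its end, so it cannot run past the end of the chain. -/
theorem exists_iterate_eq {n : ℕ} (hn : 0 < n) {i : Idx n} {B : Matrix (Fin 2) (Fin 2) ℤ}
    (hB : B ∈ cosetS (i.act matT⁻¹).1) :
    ∃ t ≤ chainLen hn i, opK^[t] (matA hn i) = B := by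
  obtain ⟨hS, hM⟩ := mem_cosetS.1 hB
  obtain ⟨B', hB', h0, t, rfl, hr⟩ := exists_triangular hS
  rw [mem_iterate_opK_iff] at hM
  obtain rfl := eq_matA hn hB' h0 hM
  refine ⟨t, ?_, rfl⟩
  by_contra! hlt
  refine hr _ hlt (zero_one_eq_zero_of_mem_setY (iterate_chainLen_mem_setY hn i))

/-- The description of `ψ̃_i` without `K`, on which all later arguments rest. No matrix occurs twice
in a chain because the upper right entry strictly decreases. -/
theorem psiTilde_eq {n : ℕ} (hn : 0 < n) (i : Idx n) :
    psiTilde hn i = ∑ B ∈ cosetS (i.act matT⁻¹).1, MonoidAlgebra.single B (1 : ℤ) := by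
  unfold psiTilde
  refine Finset.sum_bij (fun t _ => opK^[t] (matA hn i)) ?_ ?_ ?_ fun _ _ => rfl
  · intro t ht
    rw [Finset.mem_range] at ht
    exact mem_cosetS.2 ⟨iterate_opK_mem_setS hn i (by omega),
      (mem_iterate_opK_iff _ _ _).2 (mem_matA hn i)⟩
  · intro t ht u hu h
    rw [Finset.mem_range] at ht hu
    rcases lt_trichotomy t u with hlt | heq | hlt
    · exact absurd (iterate_opK_lt hn i hlt (by omega)) (by rw [h]; exact lt_irrefl _)
    · exact heq
    · exact absurd (iterate_opK_lt hn i hlt (by omega)) (by rw [h]; exact lt_irrefl _)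
  · intro B hB
    obtain ⟨t, ht, rfl⟩ := exists_iterate_eq hn hB
    exact ⟨t, Finset.mem_range.2 (by omega), rfl⟩

end Lewis

namespace Lewis

open Matrix

/-! ### The three term identity for the sets `S_n` -/

/-- The matrix `(1 0; 1 1)`. -/
def matT' : GL (Fin 2) ℤ where
  val := !![1, 0; 1, 1]
  inv := !![1, 0; -1, 1]
  val_inv := by decide
  inv_val := by decide

/-- The nonnegative matrices of determinant `n`. -/
def setP (n : ℕ) : Set (Matrix (Fin 2) (Fin 2) ℤ) :=
  {A | 0 ≤ A 0 0 ∧ 0 ≤ A 0 1 ∧ 0 ≤ A 1 0 ∧ 0 ≤ A 1 1 ∧ A 0 0 * A 1 1 - A 0 1 * A 1 0 = n}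

/-- The matrices `(a b; c d)` with `a > b ≥ 0`, `d > c ≥ 0` and determinant `n`. -/
def setX (n : ℕ) : Set (Matrix (Fin 2) (Fin 2) ℤ) :=
  {A | A 0 0 > A 0 1 ∧ A 0 1 ≥ 0 ∧ A 1 1 > A 1 0 ∧ A 1 0 ≥ 0 ∧
    A 0 0 * A 1 1 - A 0 1 * A 1 0 = n}

theorem finite_setX (n : ℕ) : (setX n).Finite := by
  refine ((finite_setS n).preimage (f := transpose) transpose_injective.injOn).subset ?_
  rintro A ⟨h1, h2, h3, h4, h5⟩
  exact ⟨h1, h2, h3, h4, by simp only [transpose_apply]; linarith⟩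

theorem setX_subset_setP (n : ℕ) : setX n ⊆ setP n := by
  rintro A ⟨h1, h2, h3, h4, h5⟩
  exact ⟨by omega, by omega, by omega, by omega, h5⟩

theorem setS_subset_setP (n : ℕ) : setS n ⊆ setP n := by
  rintro A ⟨h1, h2, h3, h4, h5⟩
  exact ⟨by omega, by omega, by omega, by omega, h5⟩

theorem isNonneg_of_mem_setP {n : ℕ} (hn : 0 < n) {A : Matrix (Fin 2) (Fin 2) ℤ}
    (hA : A ∈ setP n) : IsNonneg A := by
  obtain ⟨h1, h2, h3, h4, h5⟩ := hA
  refine ⟨h1, h2, h3, h4, ?_⟩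
  rw [det_fin_two, h5]
  exact_mod_cast hn.ne'

open Classical in
/-- The indicator function of `U`. -/
noncomputable def ind {α : Type*} (U : Set α) (B : α) : ℂ := if B ∈ U then 1 else 0

theorem ind_eq_ite {α : Type*} {U : Set α} {B : α} {p : Prop} [Decidable p] (h : B ∈ U ↔ p) :
    ind U B = if p then 1 else 0 := by
  simp [ind, h]

theorem ind_congr {α : Type*} {U V : Set α} {B C : α} (h : B ∈ U ↔ C ∈ V) : ind U B = ind V C := by
  classical exact ind_eq_ite h

theorem matT_inv_mul (B : Matrix (Fin 2) (Fin 2) ℤ) :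
    matT⁻¹.1 * B = !![B 0 0 - B 1 0, B 0 1 - B 1 1; B 1 0, B 1 1] := by
  ext i j
  fin_cases i <;> fin_cases j <;>
    simp [matT, Units.inv_mk, mul_apply, Fin.sum_univ_two, sub_eq_add_neg]

theorem matT'_inv_mul (B : Matrix (Fin 2) (Fin 2) ℤ) :
    matT'⁻¹.1 * B = !![B 0 0, B 0 1; B 1 0 - B 0 0, B 1 1 - B 0 1] := by
  ext i j
  fin_cases i <;> fin_cases j <;>
    simp [matT', Units.inv_mk, mul_apply, Fin.sum_univ_two, sub_eq_add_neg, add_comm]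

/-- Compare the two rows of a nonnegative matrix entrywise. The subtracted terms mark upper row ≥
lower row and lower row ≥ upper row; the incomparable rows that are left form `S_n`. Indicator
functions are used because `setP n` is infinite. -/
theorem indicator_setS {n : ℕ} (hn : 0 < n) (B : Matrix (Fin 2) (Fin 2) ℤ) :
    ind (setS n) B = ind (setP n) B
      - ind (setP n) (matT⁻¹.1 * B) - ind (setP n) (matT'⁻¹.1 * B) := by
  have hn' : (0 : ℤ) < n := by exact_mod_cast hn
  have e1 : (B 0 0 - B 1 0) * B 1 1 - (B 0 1 - B 1 1) * B 1 0 =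
    B 0 0 * B 1 1 - B 0 1 * B 1 0 := by ring
  have e2 : B 0 0 * (B 1 1 - B 0 1) - B 0 1 * (B 1 0 - B 0 0) =
    B 0 0 * B 1 1 - B 0 1 * B 1 0 := by ring
  have hT : (matT⁻¹.1 * B) ∈ setP n ↔ 0 ≤ B 0 0 - B 1 0 ∧ 0 ≤ B 0 1 - B 1 1 ∧ 0 ≤ B 1 0 ∧
      0 ≤ B 1 1 ∧ B 0 0 * B 1 1 - B 0 1 * B 1 0 = n := by
    rw [← e1, matT_inv_mul]
    simp [setP]
  have hT' : (matT'⁻¹.1 * B) ∈ setP n ↔ 0 ≤ B 0 0 ∧ 0 ≤ B 0 1 ∧ 0 ≤ B 1 0 - B 0 0 ∧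
      0 ≤ B 1 1 - B 0 1 ∧ B 0 0 * B 1 1 - B 0 1 * B 1 0 = n := by
    rw [← e2, matT'_inv_mul]
    simp [setP]
  have hS : B ∈ setS n ↔ B 0 0 > B 1 0 ∧ B 1 0 ≥ 0 ∧ B 1 1 > B 0 1 ∧ B 0 1 ≥ 0 ∧
    B 0 0 * B 1 1 - B 0 1 * B 1 0 = n := Iff.rfl
  have hP : B ∈ setP n ↔ 0 ≤ B 0 0 ∧ 0 ≤ B 0 1 ∧ 0 ≤ B 1 0 ∧ 0 ≤ B 1 1 ∧
    B 0 0 * B 1 1 - B 0 1 * B 1 0 = n := Iff.rfl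
  rw [ind_eq_ite hT, ind_eq_ite hT', ind_eq_ite hS, ind_eq_ite hP]
  generalize B 0 0 = a at *
  generalize B 0 1 = b at *
  generalize B 1 0 = c at *
  generalize B 1 1 = d at *
  by_cases hdet : a * d - b * c = n
  -- Positivity of the determinant excludes both equal rows, which would be subtracted twice, and
  -- the wrong type of incomparable rows.
  · have key : ¬ (0 ≤ a ∧ 0 ≤ d ∧ a ≤ c ∧ d ≤ b) := by
      rintro ⟨h1, h2, h3, h4⟩
      have := mul_le_mul h3 h4 h2 (h1.trans h3)
      linarith
    simp only [hdet, and_true]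
    split_ifs <;> first | omega | simp
  · simp [hdet]

/-- Transposition preserves `setP n` and exchanges `setX` with `setS`, `T` with `T'`, and left with
right multiplication. -/
theorem indicator_setX {n : ℕ} (hn : 0 < n) (B : Matrix (Fin 2) (Fin 2) ℤ) :
    ind (setX n) B = ind (setP n) B
      - ind (setP n) (B * matT⁻¹.1) - ind (setP n) (B * matT'⁻¹.1) := by
  have hP : ∀ C, C ∈ setP n ↔ Cᵀ ∈ setP n := by
    intro C
    simp only [setP, Set.mem_ofPred_eq, transpose_apply, mul_comm (C 1 0)]
    tauto
  have hX : B ∈ setX n ↔ Bᵀ ∈ setS n := by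
    simp only [setX, setS, Set.mem_ofPred_eq, transpose_apply, mul_comm (B 1 0)]
  have e1 : (B * matT⁻¹.1)ᵀ = matT'⁻¹.1 * Bᵀ := by
    rw [transpose_mul]; congr 1
    ext i j; fin_cases i <;> fin_cases j <;> simp [matT, matT', Units.inv_mk]
  have e2 : (B * matT'⁻¹.1)ᵀ = matT⁻¹.1 * Bᵀ := by
    rw [transpose_mul]; congr 1
    ext i j; fin_cases i <;> fin_cases j <;> simp [matT, matT', Units.inv_mk]
  rw [ind_congr hX, indicator_setS hn, ← e1, ← e2, ← ind_congr (hP _), ← ind_congr (hP _),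
    ← ind_congr (hP _)]
  ring

/-- Both sides expand to `(1 - T - T') P (1 - T - T')`, because left and right multiplications
commute. -/
theorem indicator_setS_sub {n : ℕ} (hn : 0 < n) (B : Matrix (Fin 2) (Fin 2) ℤ) :
    ind (setS n) B - ind (setS n) (B * matT⁻¹.1)
        - ind (setS n) (B * matT'⁻¹.1) =
      ind (setX n) B - ind (setX n) (matT⁻¹.1 * B)
        - ind (setX n) (matT'⁻¹.1 * B) := by
  simp only [indicator_setS hn, indicator_setX hn, mul_assoc]
  ring

/-! ### From indicator functions to sums over cosets -/

open Classical in
theorem sum_cosetS {n : ℕ} (j : ProjPair n) (f : Matrix (Fin 2) (Fin 2) ℤ → ℂ) :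
    ∑ B ∈ cosetS j, f B =
      ∑ᶠ B, ind (setS n) B * ((if j.Mem B then 1 else 0) * f B) := by
  rw [finsum_eq_sum_of_support_subset (s := cosetS j)]
  · refine Finset.sum_congr rfl fun B hB => ?_
    obtain ⟨h1, h2⟩ := mem_cosetS.1 hB
    simp [ind, h1, h2]
  · intro B hB
    rw [Finset.mem_coe, mem_cosetS]
    by_contra h
    refine hB ?_
    by_cases h1 : B ∈ setS n
    · have h2 : ¬ j.Mem B := fun h2 => h ⟨h1, h2⟩
      simp [h2]
    · simp [ind, h1]

open Classical in
theorem sum_cosetS_act {n : ℕ} (j : ProjPair n) (f : Matrix (Fin 2) (Fin 2) ℤ → ℂ)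
    (g : GL (Fin 2) ℤ) :
    ∑ B ∈ cosetS (j.act g⁻¹.1), f (B * g.1) =
      ∑ᶠ B, ind (setS n) (B * g⁻¹.1) * ((if j.Mem B then 1 else 0) * f B) := by
  rw [sum_cosetS]
  conv_rhs => rw [← finsum_comp_equiv (Units.mulRight g)]
  refine finsum_congr fun B => ?_
  have h1 : B * g.1 * g⁻¹.1 = B := by
    rw [mul_assoc, ← Units.val_mul, mul_inv_cancel, Units.val_one, mul_one]
  have h2 : (j.act g⁻¹.1).Mem B ↔ j.Mem (B * g.1) := by
    rw [← mem_act_iff j (B * g.1) g⁻¹, h1]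
  simp only [Units.mulRight_apply, h1, h2]

theorem finite_support_indicator_mul {α : Type*} {U : Set α} (hU : U.Finite) {e : α → α}
    (he : Function.Injective e) (h : α → ℂ) :
    (fun B => ind U (e B) * h B).HasFiniteSupport := by
  refine (hU.preimage he.injOn).subset fun B hB => ?_
  by_contra hB'
  exact hB (by simp [ind, show e B ∉ U from hB'])

theorem finsum_sub_sub {α : Type*} {F G H : α → ℂ} (hF : F.HasFiniteSupport)
    (hG : G.HasFiniteSupport) (hH : H.HasFiniteSupport) :
    ∑ᶠ B, F B - ∑ᶠ B, G B - ∑ᶠ B, H B = ∑ᶠ B, (F B - G B - H B) := by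
  rw [← finsum_sub_distrib hF hG]
  refine (finsum_sub_distrib ((hF.union hG).subset fun B hB => ?_) hH).symm
  by_contra h
  simp only [Set.mem_union, Function.mem_support, not_or, not_not] at h
  exact hB (by simp [h])

/-- The three term relation is inherited by the sums over `S_n`. -/
theorem sum_cosetS_three_term {n : ℕ} (hn : 0 < n) (j : ProjPair n)
    (f : Matrix (Fin 2) (Fin 2) ℤ → ℂ)
    (hf : ∀ B ∈ setP n, f B = f (matT.1 * B) + f (matT'.1 * B)) :
    ∑ B ∈ cosetS j, f B = ∑ B ∈ cosetS (j.act matT⁻¹.1), f (B * matT.1) +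
      ∑ B ∈ cosetS (j.act matT'⁻¹.1), f (B * matT'.1) := by
  classical
  have hinjL : ∀ g : GL (Fin 2) ℤ, Function.Injective fun B => g.1 * B :=
    fun g => (Units.mulLeft g).injective
  have hinjR : ∀ g : GL (Fin 2) ℤ, Function.Injective fun B => B * g.1 :=
    fun g => (Units.mulRight g).injective
  have hL : ∀ g : GL (Fin 2) ℤ,
      ∑ᶠ B, ind (setX n) (g⁻¹.1 * B) * ((if j.Mem B then 1 else 0) * f B) =
      ∑ᶠ B, ind (setX n) B * ((if j.Mem B then 1 else 0) * f (g.1 * B)) := by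
    intro g
    conv_lhs => rw [← finsum_comp_equiv (Units.mulLeft g)]
    refine finsum_congr fun B => ?_
    have h1 : g⁻¹.1 * (g.1 * B) = B := by
      rw [← mul_assoc, ← Units.val_mul, inv_mul_cancel, Units.val_one, one_mul]
    simp only [Units.mulLeft_apply, h1, mem_mul_left_iff]
  have hS := finite_setS n
  have hX := finite_setX n
  have hXi : ∀ h : Matrix (Fin 2) (Fin 2) ℤ → ℂ,
      (fun B => ind (setX n) B * h B).HasFiniteSupport :=
    fun h => finite_support_indicator_mul hX Function.injective_id h
  have hSi : ∀ h : Matrix (Fin 2) (Fin 2) ℤ → ℂ,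
      (fun B => ind (setS n) B * h B).HasFiniteSupport :=
    fun h => finite_support_indicator_mul hS Function.injective_id h
  rw [← sub_eq_zero, ← sub_sub, sum_cosetS, sum_cosetS_act, sum_cosetS_act,
    finsum_sub_sub (hSi _)
      (finite_support_indicator_mul hS (hinjR _) _) (finite_support_indicator_mul hS (hinjR _) _)]
  -- Here the right translates of `S_n` are traded for left translates of `X_n`; the latter keep `j`
  -- fixed, so the relation for `f` applies term by term.
  simp only [← sub_mul, indicator_setS_sub hn]
  simp only [sub_mul]
  rw [← finsum_sub_sub (hXi _) (finite_support_indicator_mul hX (hinjL _) _)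
    (finite_support_indicator_mul hX (hinjL _) _), hL, hL, finsum_sub_sub (hXi _) (hXi _) (hXi _),
    ← finsum_zero (α := Matrix (Fin 2) (Fin 2) ℤ)]
  refine finsum_congr fun B => ?_
  by_cases hB : B ∈ setX n
  · rw [hf B (setX_subset_setP n hB)]; ring
  · simp [ind, hB]

end Lewis

namespace Lewis

open Matrix Complex

/-! ### The Lewis system -/

theorem isNonneg_matT : IsNonneg matT.1 := by
  simp [IsNonneg, matT, det_fin_two]

theorem isNonneg_matT' : IsNonneg matT'.1 := by
  simp [IsNonneg, matT', det_fin_two]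

theorem isNonneg_matM : IsNonneg matM.1 := by
  simp [IsNonneg, matM, det_fin_two]

theorem matT_mul_matM : matT.1 * matM.1 = matM.1 * matT'.1 := by decide

theorem matM_mul_matM : matM.1 * matM.1 = 1 := by decide

theorem slashMat_matT (s : ℂ) (φ : ℂ → ℂ) (z : ℂ) : slashMat s φ matT.1 z = φ (z + 1) := by
  simp [slashMat, matT, det_fin_two]

theorem slashMat_matT_mul_matM (s : ℂ) (φ : ℂ → ℂ) {z : ℂ} (hz : z ≠ 0) :
    slashMat s φ (matT.1 * matM.1) z = z ^ (-2 * s) * φ (1 + 1 / z) := by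
  have h : (z + 1) / z = 1 + 1 / z := by field_simp
  rw [← h]
  simp [slashMat, matT, matM, det_fin_two]

theorem slashMat_add_mul (s c : ℂ) (φ ψ : ℂ → ℂ) (A : Matrix (Fin 2) (Fin 2) ℤ) (z : ℂ) :
    slashMat s (fun z => φ z + c * ψ z) A z = slashMat s φ A z + c * slashMat s ψ A z := by
  simp only [slashMat_eq]; ring

variable {s lam : ℂ} {φ : ℂ → ℂ}

/-- Acting by `M` on `φ = φ|T + λ φ|TM` interchanges the two terms, and `λ² = 1`. -/
theorem IsLewisSolution.slashMat_matM (hlam : lam = 1 ∨ lam = -1) (hφ : IsLewisSolution s lam φ)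
    {z : ℂ} (hz : z ∈ slitPlane) : slashMat s φ matM.1 z = lam * φ z := by
  have hTM := isNonneg_matT.mul isNonneg_matM
  have key : ∀ z ∈ slitPlane,
      φ z = slashMat s φ matT.1 z + lam * slashMat s φ (matT.1 * matM.1) z := by
    intro z hz
    rw [slashMat_matT, slashMat_matT_mul_matM s φ (slitPlane_ne_zero hz), hφ.2 z hz]
    ring
  have h1 := slashMat_congr (s := s) key isNonneg_matM hz
  rw [slashMat_add_mul, ← isNonneg_matT.slashMat_mul isNonneg_matM hz,
    ← hTM.slashMat_mul isNonneg_matM hz, mul_assoc, matM_mul_matM, mul_one] at h1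
  rw [h1, key z hz]
  rcases hlam with rfl | rfl <;> ring

theorem IsLewisSolution.slashMat_matM_mul (hlam : lam = 1 ∨ lam = -1)
    (hφ : IsLewisSolution s lam φ) {B : Matrix (Fin 2) (Fin 2) ℤ} (hB : IsNonneg B) {z : ℂ}
    (hz : z ∈ slitPlane) : lam * slashMat s φ (matM.1 * B) z = slashMat s φ B z := by
  rw [isNonneg_matM.slashMat_mul hB hz,
    slashMat_congr (fun z hz => hφ.slashMat_matM hlam hz) hB hz]
  simp only [slashMat_eq]
  rcases hlam with rfl | rfl <;> ring

theorem IsLewisSolution.three_term (hlam : lam = 1 ∨ lam = -1) (hφ : IsLewisSolution s lam φ)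
    {B : Matrix (Fin 2) (Fin 2) ℤ} (hB : IsNonneg B) {z : ℂ} (hz : z ∈ slitPlane) :
    slashMat s φ B z = slashMat s φ (matT.1 * B) z + slashMat s φ (matT'.1 * B) z := by
  have key : ∀ z ∈ slitPlane, φ z = slashMat s φ matT.1 z + 1 * slashMat s φ matT'.1 z := by
    intro z hz
    rw [← hφ.slashMat_matM_mul hlam isNonneg_matT' hz, ← matT_mul_matM, slashMat_matT,
      slashMat_matT_mul_matM s φ (slitPlane_ne_zero hz), hφ.2 z hz]
    ring
  rw [slashMat_congr key hB hz, slashMat_add_mul, isNonneg_matT.slashMat_mul hB hz,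
    isNonneg_matT'.slashMat_mul hB hz, one_mul]

theorem conj_matM_mem_setS {n : ℕ} {B : Matrix (Fin 2) (Fin 2) ℤ} (hB : B ∈ setS n) :
    matM.1 * B * matM.1 ∈ setS n := by
  obtain ⟨h1, h2, h3, h4, h5⟩ := hB
  have e : matM.1 * B * matM.1 = !![B 1 1, B 1 0; B 0 1, B 0 0] := by
    ext i j
    fin_cases i <;> fin_cases j <;> simp [matM, mul_apply, vecMul, dotProduct, Fin.sum_univ_two]
  rw [e]
  exact ⟨h3, h4, h1, h2, by simp; linarith⟩

theorem conj_matM_mem_cosetS {n : ℕ} {j : ProjPair n} {B : Matrix (Fin 2) (Fin 2) ℤ}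
    (hB : B ∈ cosetS j) : matM.1 * B * matM.1 ∈ cosetS (j.act matM.1) := by
  obtain ⟨h1, h2⟩ := mem_cosetS.1 hB
  exact mem_cosetS.2 ⟨conj_matM_mem_setS h1, (h2.mul_left _).mul_right _⟩

theorem sum_cosetS_conj_matM {n : ℕ} (j : ProjPair n) (f : Matrix (Fin 2) (Fin 2) ℤ → ℂ) :
    ∑ B ∈ cosetS (j.act matM.1), f B = ∑ B ∈ cosetS j, f (matM.1 * B * matM.1) := by
  have hinv : ∀ B : Matrix (Fin 2) (Fin 2) ℤ, matM.1 * (matM.1 * B * matM.1) * matM.1 = B := by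
    intro B
    rw [mul_assoc, mul_assoc, mul_assoc, matM_mul_matM, mul_one, ← mul_assoc, matM_mul_matM,
      one_mul]
  symm
  refine Finset.sum_nbij' (fun B => matM.1 * B * matM.1) (fun B => matM.1 * B * matM.1)
    (fun B hB => conj_matM_mem_cosetS hB) (fun B hB => ?_) (fun B _ => hinv B)
    (fun B _ => hinv B) fun B _ => rfl
  have := conj_matM_mem_cosetS hB
  rwa [ProjPair.act_act, matM_mul_matM, ProjPair.act_one] at this

theorem slash_psiTilde {n : ℕ} (hn : 0 < n) (i : Idx n) (s : ℂ) (φ : ℂ → ℂ) (z : ℂ) :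
    slash s φ (psiTilde hn i) z = ∑ B ∈ cosetS (i.act matT⁻¹).1, slashMat s φ B z := by
  rw [psiTilde_eq, slash_sum_single s φ _ fun B => B]

/-- The family `(φ |_s ψ̃_i)` solves the Lewis system. -/
theorem isLewisSystemSolution_psiTilde {n : ℕ} (hn : 0 < n) (hlam : lam = 1 ∨ lam = -1)
    (hφ : IsLewisSolution s lam φ) :
    IsLewisSystemSolution n s lam fun i => slash s φ (psiTilde hn i) := by
  have hnonneg : ∀ {j : ProjPair n} {B}, B ∈ cosetS j → IsNonneg B := fun hB =>
    isNonneg_of_mem_setP hn (setS_subset_setP n (mem_cosetS.1 hB).1)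
  refine ⟨fun i => ?_, fun i z hz => ?_⟩
  · have e : slash s φ (psiTilde hn i) =
        fun z => ∑ B ∈ cosetS (i.act matT⁻¹).1, slashMat s φ B z :=
      funext fun z => slash_psiTilde hn i s φ z
    change DifferentiableOn ℂ (slash s φ (psiTilde hn i)) slitPlane
    rw [e]
    exact DifferentiableOn.fun_sum fun B hB => differentiableOn_slashMat hφ.1 (hnonneg hB)
  · have hz0 := slitPlane_ne_zero hz
    simp only [slash_psiTilde]
    obtain ⟨j, hj⟩ : ∃ j, j = (i.act matT⁻¹).1 := ⟨_, rfl⟩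
    have e1 : ((i.act matT⁻¹).act matT⁻¹).1 = j.act matT⁻¹.1 := by rw [hj]; rfl
    have e2 : ((i.act (matT⁻¹ * matM)).act matT⁻¹).1 = (j.act matT'⁻¹.1).act matM.1 := by
      -- The relation `MT⁻¹ = T'⁻¹M` identifies the third index of the system with the `T'` coset up
      -- to `M`.
      have hm : matT⁻¹.1 * matM.1 * matT⁻¹.1 = matT⁻¹.1 * (matT'⁻¹.1 * matM.1) := by decide
      change (i.1.act (matT⁻¹.1 * matM.1)).act matT⁻¹.1 = _
      rw [hj, ProjPair.act_act, hm, ProjPair.act_act, ← ProjPair.act_act]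
      rfl
    rw [e1, e2, ← hj, sum_cosetS_three_term hn j (fun B => slashMat s φ B z)
      fun B hB => hφ.three_term hlam (isNonneg_of_mem_setP hn hB) hz, sum_cosetS_conj_matM,
      Finset.mul_sum, sub_sub, sub_eq_zero]
    congr 1
    · refine Finset.sum_congr rfl fun B hB => ?_
      rw [(hnonneg hB).slashMat_mul isNonneg_matT hz, slashMat_matT]
    · refine Finset.sum_congr rfl fun B hB => ?_
      -- Conjugation by `M` preserves `S_n`, and `(MBM)(TM) = M(BT')`; the leftover `M` on the left
      -- is absorbed by the factor `λ`.
      have h1 := (isNonneg_matM.mul (hnonneg hB)).mul isNonneg_matM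
      have h2 : matM.1 * B * matM.1 * (matT.1 * matM.1) = matM.1 * (B * matT'.1) := by
        rw [matT_mul_matM, mul_assoc, ← mul_assoc matM.1 matM.1, matM_mul_matM, one_mul, mul_assoc]
      rw [mul_assoc, ← slashMat_matT_mul_matM _ _ hz0,
        ← h1.slashMat_mul (isNonneg_matT.mul isNonneg_matM) hz, h2,
        hφ.slashMat_matM_mul hlam ((hnonneg hB).mul isNonneg_matT') hz]

end Lewis

namespace Lewis

open Matrix Complex

/-! ### Contents of matrices -/

/-- The greatest common divisor of the entries. -/
def content (A : Matrix (Fin 2) (Fin 2) ℤ) : ℕ :=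
  Nat.gcd (Int.gcd (A 0 0) (A 0 1)) (Int.gcd (A 1 0) (A 1 1))

theorem dvd_content_iff {e : ℕ} {A : Matrix (Fin 2) (Fin 2) ℤ} :
    e ∣ content A ↔ ∀ r t, (e : ℤ) ∣ A r t := by
  simp only [content, Nat.dvd_gcd_iff, Int.dvd_gcd_iff, Fin.forall_fin_two]

theorem content_dvd (A : Matrix (Fin 2) (Fin 2) ℤ) (r t : Fin 2) : (content A : ℤ) ∣ A r t :=
  dvd_content_iff.1 dvd_rfl r t

theorem content_dvd_content_mul (C A : Matrix (Fin 2) (Fin 2) ℤ) :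
    content A ∣ content (C * A) := by
  rw [dvd_content_iff]
  intro r t
  rw [mul_apply, Fin.sum_univ_two]
  exact dvd_add ((content_dvd A _ _).mul_left _) ((content_dvd A _ _).mul_left _)

theorem content_mul_left (g : GL (Fin 2) ℤ) (A : Matrix (Fin 2) (Fin 2) ℤ) :
    content (g.1 * A) = content A := by
  refine Nat.dvd_antisymm ?_ (content_dvd_content_mul _ _)
  have := content_dvd_content_mul g⁻¹.1 (g.1 * A)
  rwa [← mul_assoc, ← Units.val_mul, inv_mul_cancel, Units.val_one, one_mul] at this

theorem content_iterate_opK (A : Matrix (Fin 2) (Fin 2) ℤ) (t : ℕ) :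
    content (opK^[t] A) = content A := by
  induction t with
  | zero => rfl
  | succ t ih => rw [Function.iterate_succ_apply', opK_eq, content_mul_left, ih]

/-! ### The Hecke operator `T̃_n` as the sum of the `ψ̃_i` -/

theorem matA_paramEquiv {n : ℕ} (hn : 0 < n) (p : Admissible n) :
    matA hn (paramEquiv hn p) = !![(p.1.1 : ℤ), (p.1.2 : ℤ); 0, ((n / p.1.1 : ℕ) : ℤ)] := by
  simp [matA]

theorem matA_injective {n : ℕ} (hn : 0 < n) : Function.Injective (matA hn) := by
  intro i i' h
  obtain ⟨p, rfl⟩ := (paramEquiv hn).surjective i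
  obtain ⟨q, rfl⟩ := (paramEquiv hn).surjective i'
  rw [matA_paramEquiv, matA_paramEquiv] at h
  have h1 := congrFun (congrFun h 0) 0
  have h2 := congrFun (congrFun h 0) 1
  simp at h1 h2
  exact congrArg _ (Subtype.ext (Prod.ext h1 h2))

theorem content_matA {n : ℕ} (hn : 0 < n) (i : Idx n) : content (matA hn i) = 1 := by
  obtain ⟨p, rfl⟩ := (paramEquiv hn).surjective i
  have h := fun r t => content_dvd (matA hn (paramEquiv hn p)) r t
  generalize content (matA hn (paramEquiv hn p)) = e at h
  rw [matA_paramEquiv] at h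
  have h00 := h 0 0
  have h01 := h 0 1
  have h11 := h 1 1
  simp only [of_apply, cons_val', cons_val_zero, cons_val_one, cons_val_fin_one,
    Int.natCast_dvd_natCast] at h00 h01 h11
  obtain ⟨k, -, hk⟩ := p.2.2.2.2
  exact Nat.dvd_one.1 (hk ▸ Nat.dvd_gcd h00 (dvd_add h01 (h11.mul_left k)))

/-- Admissibility of `(c, b)` amounts to content 1: if no prime divides `c`, `b` and `d`, some `b +
kd` is prime to `c`, and `k` matters only modulo `c`. -/
theorem exists_matA_eq {n : ℕ} (hn : 0 < n) {B : Matrix (Fin 2) (Fin 2) ℤ} (hB : B ∈ setS n)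
    (h0 : B 1 0 = 0) (hc : content B = 1) : ∃ i, matA hn i = B := by
  obtain ⟨h1, h2, h3, h4, h5⟩ := hB
  rw [h0] at h1 h5
  obtain ⟨c, ha⟩ := Int.eq_ofNat_of_zero_le h1.le
  obtain ⟨b, hb⟩ := Int.eq_ofNat_of_zero_le h4
  obtain ⟨d, hd⟩ := Int.eq_ofNat_of_zero_le (h4.trans h3.le)
  have hcd : c * d = n := by
    rw [ha, hd] at h5
    have : (c : ℤ) * d = n := by linarith
    exact_mod_cast this
  have hc0 : 0 < c := by omega
  have hdn : n / c = d := by rw [← hcd, Nat.mul_div_cancel_left d hc0]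
  have hbd : b < d := by omega
  obtain ⟨k, hk⟩ := exists_coprime_add_mul hc0.ne' b d (by
    intro p pp hpa hpb hpd
    have : p ∣ content B := by
      rw [dvd_content_iff, Fin.forall_fin_two, Fin.forall_fin_two, Fin.forall_fin_two, ha, hb, hd,
        h0]
      exact ⟨⟨by exact_mod_cast hpa, hpb⟩, dvd_zero _, hpd⟩
    rw [hc] at this
    exact pp.one_lt.ne' (Nat.dvd_one.1 this))
  have hc0' : (0 : ℤ) < c := by exact_mod_cast hc0
  obtain ⟨l, hl⟩ := Int.eq_ofNat_of_zero_le (Int.emod_nonneg k hc0'.ne')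
  have hlc : l < c := by have := Int.emod_lt_of_pos k hc0'; omega
  have hadm : Nat.gcd c (b + l * d) = 1 := by
    have h6 : ((b + l * d : ℕ) : ℤ) = (b + k * d) + c * (-(k / c) * d) := by
      have := Int.mul_ediv_add_emod k c
      push_cast
      rw [hl] at this
      linear_combination (d : ℤ) * this
    have h7 : IsCoprime ((b + l * d : ℕ) : ℤ) (c : ℤ) := by
      rw [h6]; exact hk.add_mul_left_left _
    exact (Nat.isCoprime_iff_coprime.1 h7).symm
  obtain ⟨p, hp⟩ : ∃ p : Admissible n, p.1 = (c, b) :=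
    ⟨⟨(c, b), hc0, ⟨d, hcd.symm⟩, by rwa [hdn], l, hlc, by rwa [hdn]⟩, rfl⟩
  refine ⟨paramEquiv hn p, ?_⟩
  rw [matA_paramEquiv, hp]
  ext r t
  fin_cases r <;> fin_cases t <;> simp [ha, hb, hd, h0, hdn]

/-- The matrices in `S_n` of content `1`. -/
noncomputable def primS (n : ℕ) : Finset (Matrix (Fin 2) (Fin 2) ℤ) :=
  (finite_setS n).toFinset.filter fun A => content A = 1

theorem mem_primS {n : ℕ} {A : Matrix (Fin 2) (Fin 2) ℤ} :
    A ∈ primS n ↔ A ∈ setS n ∧ content A = 1 := by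
  simp [primS]

/-- The content is constant along a chain, so a primitive matrix has a primitive triangular
ancestor, which is some `A_i`. Its lattice determines that `A_i`, so the chains are disjoint. -/
theorem sum_primS {M : Type*} [AddCommMonoid M] {n : ℕ} (hn : 0 < n) [Fintype (Idx n)]
    (f : Matrix (Fin 2) (Fin 2) ℤ → M) :
    ∑ B ∈ primS n, f B = ∑ i : Idx n, ∑ B ∈ cosetS (i.act matT⁻¹).1, f B := by
  classical
  rw [← Finset.sum_biUnion]
  · refine Finset.sum_congr ?_ fun _ _ => rfl
    ext B
    simp only [Finset.mem_biUnion, Finset.mem_univ, true_and, mem_primS]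
    constructor
    · rintro ⟨hS, hc⟩
      obtain ⟨B', hB', h0, t, rfl, -⟩ := exists_triangular hS
      rw [content_iterate_opK] at hc
      obtain ⟨i, rfl⟩ := exists_matA_eq hn hB' h0 hc
      exact ⟨i, mem_cosetS.2 ⟨hS, (mem_iterate_opK_iff _ _ _).2 (mem_matA hn i)⟩⟩
    · rintro ⟨i, hi⟩
      obtain ⟨t, -, rfl⟩ := exists_iterate_eq hn hi
      exact ⟨(mem_cosetS.1 hi).1, by rw [content_iterate_opK, content_matA]⟩
  · intro i _ i' _ hne
    rw [Function.onFun, Finset.disjoint_left]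
    intro B hi hi'
    obtain ⟨hS, hM⟩ := mem_cosetS.1 hi
    have hM' := (mem_cosetS.1 hi').2
    obtain ⟨B', hB', h0, t, rfl, -⟩ := exists_triangular hS
    rw [mem_iterate_opK_iff] at hM hM'
    exact hne (matA_injective hn ((eq_matA hn hB' h0 hM).symm.trans (eq_matA hn hB' h0 hM')))

theorem slash_heckeTTilde (s : ℂ) (φ : ℂ → ℂ) (n : ℕ) (z : ℂ) :
    slash s φ (heckeTTilde n) z = ∑ B ∈ primS n, slashMat s φ B z :=
  slash_sum_single s φ _ (fun B => B) z

theorem slash_heckeTTilde_eq_sum {n : ℕ} (hn : 0 < n) [Fintype (Idx n)] (s : ℂ) (φ : ℂ → ℂ)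
    (z : ℂ) :
    slash s φ (heckeTTilde n) z = ∑ i : Idx n, slash s φ (psiTilde hn i) z := by
  simp only [slash_heckeTTilde, sum_primS hn, slash_psiTilde]

/-! ### The fibres of the reduction map -/

theorem Idx.act_act {n : ℕ} (i : Idx n) (g h : GL (Fin 2) ℤ) :
    (i.act g).act h = i.act (g * h) :=
  Subtype.ext (ProjPair.act_act _ _ _)

theorem Idx.act_one {n : ℕ} (i : Idx n) : i.act 1 = i := Subtype.ext (ProjPair.act_one _)

theorem sigma_act {n m : ℕ} (h : m ∣ n) (i : Idx n) (g : GL (Fin 2) ℤ) :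
    sigma h (i.act g) = (sigma h i).act g := by
  obtain ⟨i, hi⟩ := i
  induction i using Quotient.inductionOn with
  | h q => rfl

/-- The class `[0 : 1]`. -/
def Idx.base (n : ℕ) : Idx n := ⟨ProjPair.mk n 0 1, 1, (ProjPair.act_one _).symm⟩

theorem sigma_base {n m : ℕ} (h : m ∣ n) : sigma h (Idx.base n) = Idx.base m := rfl

theorem Idx.exists_eq_act_base {n : ℕ} (i : Idx n) : ∃ g, i = (Idx.base n).act g := by
  obtain ⟨g, hg⟩ := i.2
  exact ⟨g, Subtype.ext hg⟩

theorem base_act_eq_base_iff {n : ℕ} (g : GL (Fin 2) ℤ) :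
    (Idx.base n).act g = Idx.base n ↔ g ∈ GammaBar n := by
  have e : ((Idx.base n).act g).1 = ProjPair.mk n (g.1 1 0) (g.1 1 1) :=
    congrArg (Quotient.mk (projSetoid n)) (Prod.ext (by simp) (by simp))
  have hiff : (Idx.base n).act g = Idx.base n ↔ ((Idx.base n).act g).1 = (Idx.base n).1 :=
    ⟨congrArg Subtype.val, fun h => Subtype.ext h⟩
  rw [hiff, e]
  change _ ↔ (n : ℤ) ∣ g.1 1 0
  constructor
  · intro h
    obtain ⟨k, hk, h1, -⟩ := Quotient.exact (s := projSetoid n) h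
    exact hk.symm.dvd_of_dvd_mul_left (Int.modEq_zero_iff_dvd.1 h1)
  · intro h
    -- When `n` divides the lower left entry, invertibility of `g` makes the lower right entry a
    -- unit modulo `n`.
    refine Eq.symm (Quotient.sound (s := projSetoid n) ⟨g.1 1 1, ?_, ?_, ?_⟩)
    · obtain ⟨q, hq⟩ := h
      have h1 : g.1 * g⁻¹.1 = 1 := by simp
      have h2 := congrFun (congrFun h1 1) 1
      rw [mul_apply, Fin.sum_univ_two, hq] at h2
      exact ⟨g⁻¹.1 1 1, g⁻¹.1 0 1 * q, by simp at h2 ⊢; linarith⟩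
    · simpa using (Int.modEq_zero_iff_dvd.2 h).symm
    · simp [Int.ModEq]

/-- The left action of `GL(2, ℤ)` on `I_n` that belongs to the right action. -/
instance (n : ℕ) : MulAction (GL (Fin 2) ℤ) (Idx n) where
  smul g i := i.act g⁻¹
  one_smul i := by
    change i.act 1⁻¹ = i
    rw [inv_one, Idx.act_one]
  mul_smul g h i := by
    change i.act (g * h)⁻¹ = (i.act h⁻¹).act g⁻¹
    rw [Idx.act_act, _root_.mul_inv_rev]

theorem Idx.smul_def {n : ℕ} (g : GL (Fin 2) ℤ) (i : Idx n) : g • i = i.act g⁻¹ := rfl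

/-- Orbit and stabilizer: the fibre over `[0 : 1]` is the `Γ̄₀(m)`-orbit of `[0 : 1]`, with
stabilizer given by `Γ̄₀(n)`. The other fibres are its translates, as the reduction is equivariant.
-/
theorem card_fibre_sigma {n m : ℕ} (h : m ∣ n) (i : Idx m) :
    {j : Idx n | sigma h j = i}.ncard = (GammaBar n).relIndex (GammaBar m) := by
  have hstab : MulAction.stabilizer (GammaBar m) (Idx.base n) =
      (GammaBar n).subgroupOf (GammaBar m) := by
    ext g
    rw [MulAction.mem_stabilizer_iff, Subgroup.mem_subgroupOf, Subgroup.smul_def, Idx.smul_def,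
      base_act_eq_base_iff, inv_mem_iff]
  have horb : {j : Idx n | sigma h j = Idx.base m} = MulAction.orbit (GammaBar m) (Idx.base n) := by
    ext j
    obtain ⟨g, rfl⟩ := j.exists_eq_act_base
    rw [Set.mem_ofPred_eq, sigma_act, sigma_base, base_act_eq_base_iff, MulAction.mem_orbit_iff]
    constructor
    · intro hg
      exact ⟨⟨g⁻¹, inv_mem hg⟩, by rw [Subgroup.smul_def, Idx.smul_def, inv_inv]⟩
    · rintro ⟨γ, hγ⟩
      rw [Subgroup.smul_def, Idx.smul_def] at hγ
      have := congrArg (sigma h) hγ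
      rw [sigma_act, sigma_act, sigma_base, (base_act_eq_base_iff _).2 (inv_mem γ.2)] at this
      exact (base_act_eq_base_iff _).1 this.symm
  rw [Subgroup.relIndex, ← hstab, MulAction.index_stabilizer, ← horb]
  obtain ⟨g, rfl⟩ := i.exists_eq_act_base
  refine Set.ncard_congr (fun j _ => j.act g⁻¹) ?_ ?_ ?_
  · intro j hj
    rw [Set.mem_ofPred_eq] at hj ⊢
    rw [sigma_act, hj, Idx.act_act, mul_inv_cancel, Idx.act_one]
  · intro j j' _ _ hjj
    exact MulAction.injective g hjj
  · intro j hj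
    rw [Set.mem_ofPred_eq] at hj
    refine ⟨j.act g, ?_, ?_⟩
    · rw [Set.mem_ofPred_eq, sigma_act, hj]
    · rw [Idx.act_act, mul_inv_cancel, Idx.act_one]

theorem relIndex_ne_zero {n m : ℕ} (hn : 0 < n) (h : m ∣ n) :
    (GammaBar n).relIndex (GammaBar m) ≠ 0 := by
  have := finite_Idx hn
  rw [← card_fibre_sigma h (Idx.base m)]
  exact Set.ncard_ne_zero_of_mem (a := Idx.base n) (sigma_base h)

theorem sum_comp_sigma {n m : ℕ} (h : m ∣ n) [Fintype (Idx n)] [Fintype (Idx m)]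
    (F : Idx m → ℂ) :
    ∑ j : Idx n, F (sigma h j) = (GammaBar n).relIndex (GammaBar m) * ∑ i : Idx m, F i := by
  classical
  rw [← Finset.sum_fiberwise_of_maps_to (g := sigma h) (t := Finset.univ) fun _ _ =>
    Finset.mem_univ _, Finset.mul_sum]
  refine Finset.sum_congr rfl fun i _ => ?_
  rw [Finset.sum_congr rfl fun j hj => by rw [(Finset.mem_filter.1 hj).2], Finset.sum_const,
    nsmul_eq_mul, ← card_fibre_sigma h i, Set.ncard_eq_toFinset_card']
  congr 3
  ext j
  simp

theorem phiAverage_eq {n d : ℕ} (hn : 0 < n) (hd : d ^ 2 ∣ n) (s : ℂ) (φ : ℂ → ℂ) (z : ℂ) :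
    phiAverage hn hd s φ z = slash s φ (heckeTTilde (n / d ^ 2)) z := by
  have := finite_Idx hn
  have := finite_Idx (quot_pos hn hd)
  let _ := Fintype.ofFinite (Idx n)
  let _ := Fintype.ofFinite (Idx (n / d ^ 2))
  have h0 : ((GammaBar n).relIndex (GammaBar (n / d ^ 2)) : ℂ) ≠ 0 := by
    exact_mod_cast relIndex_ne_zero hn (Nat.div_dvd_of_dvd hd)
  have e := sum_comp_sigma (Nat.div_dvd_of_dvd hd)
    fun i => slash s φ (psiTilde (quot_pos hn hd) i) z
  rw [slash_heckeTTilde_eq_sum (quot_pos hn hd)]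
  unfold phiAverage phiTilde
  rw [e, ← mul_assoc, one_div, inv_mul_cancel₀ h0, one_mul]

end Lewis

namespace Lewis

open Matrix Complex

/-! ### Decomposition of `T_n` by the content -/

/-- The scalar matrix `(d 0; 0 d)`. -/
def scalarMat (d : ℕ) : Matrix (Fin 2) (Fin 2) ℤ := !![(d : ℤ), 0; 0, (d : ℤ)]

theorem scalarMat_mul_apply (d : ℕ) (B : Matrix (Fin 2) (Fin 2) ℤ) (r t : Fin 2) :
    (scalarMat d * B) r t = d * B r t := by
  fin_cases r <;> simp [scalarMat, mul_apply, Fin.sum_univ_two]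

theorem content_scalarMat_mul (d : ℕ) (B : Matrix (Fin 2) (Fin 2) ℤ) :
    content (scalarMat d * B) = d * content B := by
  simp only [content, scalarMat_mul_apply, Int.gcd_mul_left, Nat.gcd_mul_left, Int.natAbs_natCast]

theorem scalarMat_mul_mem_setS {n d : ℕ} (hd0 : 0 < d) (hd : d ^ 2 ∣ n)
    {B : Matrix (Fin 2) (Fin 2) ℤ} : scalarMat d * B ∈ setS n ↔ B ∈ setS (n / d ^ 2) := by
  have hd0' : (0 : ℤ) < d := by exact_mod_cast hd0
  have hn : (n : ℤ) = d ^ 2 * (n / d ^ 2 : ℕ) := by exact_mod_cast (Nat.mul_div_cancel' hd).symm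
  simp only [setS, Set.mem_ofPred_eq, scalarMat_mul_apply, gt_iff_lt, ge_iff_le,
    mul_lt_mul_iff_right₀ hd0', mul_nonneg_iff_of_pos_left hd0', hn]
  have e : (d : ℤ) * B 0 0 * (d * B 1 1) - d * B 0 1 * (d * B 1 0) =
    d ^ 2 * (B 0 0 * B 1 1 - B 0 1 * B 1 0) := by ring
  rw [e, mul_right_inj' (pow_pos hd0' 2).ne']

theorem content_sq_dvd {n : ℕ} {A : Matrix (Fin 2) (Fin 2) ℤ} (hA : A ∈ setS n) :
    content A ^ 2 ∣ n := by
  rw [← Int.natCast_dvd_natCast, ← hA.2.2.2.2, Nat.cast_pow, sq]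
  exact dvd_sub (mul_dvd_mul (content_dvd A _ _) (content_dvd A _ _))
    (mul_dvd_mul (content_dvd A _ _) (content_dvd A _ _))

/-- Sort by content `d` and divide it out: the inequalities defining `S_n` are homogeneous and the
determinant drops by `d²`. -/
theorem sum_setS {M : Type*} [AddCommMonoid M] {n : ℕ} (hn : 0 < n)
    (f : Matrix (Fin 2) (Fin 2) ℤ → M) :
    ∑ A ∈ (finite_setS n).toFinset, f A =
      ∑ d ∈ n.divisors with d ^ 2 ∣ n, ∑ B ∈ primS (n / d ^ 2), f (scalarMat d * B) := by
  rw [← Finset.sum_fiberwise_of_maps_to (g := content)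
    (t := n.divisors.filter fun d => d ^ 2 ∣ n)]
  · refine Finset.sum_congr rfl fun d hd => ?_
    rw [Finset.mem_filter, Nat.mem_divisors] at hd
    have hd0 : 0 < d := Nat.pos_of_dvd_of_pos hd.1.1 hn
    have hd0' : (d : ℤ) ≠ 0 := by exact_mod_cast hd0.ne'
    symm
    refine Finset.sum_bij (fun B _ => scalarMat d * B) ?_ ?_ ?_ fun _ _ => rfl
    · intro B hB
      rw [mem_primS] at hB
      rw [Finset.mem_filter, Set.Finite.mem_toFinset, scalarMat_mul_mem_setS hd0 hd.2,
        content_scalarMat_mul, hB.2, mul_one]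
      exact ⟨hB.1, rfl⟩
    · intro B _ C _ h
      ext r t
      have := congrFun (congrFun h r) t
      rw [scalarMat_mul_apply, scalarMat_mul_apply] at this
      exact mul_left_cancel₀ hd0' this
    · intro A hA
      rw [Finset.mem_filter, Set.Finite.mem_toFinset] at hA
      obtain ⟨hS, hc⟩ := hA
      choose B hB using fun r t => hc ▸ content_dvd A r t
      have e : scalarMat d * of B = A := by
        ext r t
        rw [scalarMat_mul_apply, hB r t]
        rfl
      refine ⟨of B, mem_primS.2 ⟨?_, ?_⟩, e⟩
      · rwa [← scalarMat_mul_mem_setS hd0 hd.2, e]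
      · have := content_scalarMat_mul d (of B)
        rw [e, hc] at this
        exact (Nat.eq_of_mul_eq_mul_left hd0 (by rw [mul_one]; exact this)).symm
  · intro A hA
    rw [Set.Finite.mem_toFinset] at hA
    have h := content_sq_dvd hA
    rw [Finset.mem_filter, Nat.mem_divisors]
    exact ⟨⟨(dvd_pow_self _ two_ne_zero).trans h, hn.ne'⟩, h⟩

theorem heckeT_eq_sum {n : ℕ} (hn : 0 < n) :
    heckeT n = ∑ d ∈ n.divisors with d ^ 2 ∣ n,
      MonoidAlgebra.single (scalarMat d) (1 : ℤ) * heckeTTilde (n / d ^ 2) := by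
  unfold heckeT
  rw [sum_setS hn]
  refine Finset.sum_congr rfl fun d _ => ?_
  change _ = _ * ∑ A ∈ primS (n / d ^ 2), MonoidAlgebra.single A (1 : ℤ)
  simp only [Finset.mul_sum, MonoidAlgebra.single_mul_single, mul_one]

theorem isNonneg_scalarMat {d : ℕ} (hd : 0 < d) : IsNonneg (scalarMat d) := by
  simp [IsNonneg, scalarMat, det_fin_two, hd.ne']

/-- The determinant contributes `(d²) ^ s = d ^ (2s)`, which cancels the automorphy factor `d ^
(-2s)`; no branch problem arises for positive integers. -/
theorem slashMat_scalarMat {d : ℕ} (hd : 0 < d) (s : ℂ) (φ : ℂ → ℂ) (z : ℂ) :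
    slashMat s φ (scalarMat d) z = φ z := by
  have hd0 : (d : ℂ) ≠ 0 := by exact_mod_cast hd.ne'
  have hdet : ((|(scalarMat d).det| : ℤ) : ℂ) ^ s = (d : ℂ) ^ s * (d : ℂ) ^ s := by
    have e : |(scalarMat d).det| = ((d : ℕ) : ℤ) * (d : ℕ) := by
      simp [scalarMat, det_fin_two]
    rw [e, Int.cast_mul, Int.cast_natCast, natCast_mul_natCast_cpow]
  rw [slashMat_eq, hdet]
  have e1 : denom (scalarMat d) z = d := by simp [denom, scalarMat]
  have e2 : moebius (scalarMat d) z = z := by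
    rw [moebius, e1]
    simp [scalarMat]
    field_simp
  rw [e1, e2, ← cpow_add _ _ hd0, ← cpow_add _ _ hd0]
  have e3 : s + s + -2 * s = 0 := by ring
  rw [e3, cpow_zero, one_mul]

theorem slash_heckeT {n : ℕ} (hn : 0 < n) (s : ℂ) (φ : ℂ → ℂ) {z : ℂ} (hz : z ∈ slitPlane) :
    slash s φ (heckeT n) z =
      ∑ d ∈ n.divisors with d ^ 2 ∣ n, slash s φ (heckeTTilde (n / d ^ 2)) z := by
  unfold heckeT
  rw [slash_sum_single s φ _ fun A => A, sum_setS hn]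
  refine Finset.sum_congr rfl fun d hd => ?_
  rw [Finset.mem_filter, Nat.mem_divisors] at hd
  have hd0 : 0 < d := Nat.pos_of_dvd_of_pos hd.1.1 hn
  rw [slash_heckeTTilde]
  refine Finset.sum_congr rfl fun B hB => ?_
  have hBn := isNonneg_of_mem_setP (quot_pos hn hd.2) (setS_subset_setP _ (mem_primS.1 hB).1)
  rw [(isNonneg_scalarMat hd0).slashMat_mul hBn hz,
    slashMat_congr (fun z _ => slashMat_scalarMat hd0 s φ z) hBn hz]

/-! ### Sums of solutions -/

theorem add_one_mem_slitPlane {z : ℂ} (hz : z ∈ slitPlane) : z + 1 ∈ slitPlane := by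
  simpa using linear_mem_slitPlane (p := 1) (q := 1) zero_le_one zero_le_one (by simp) hz

theorem one_add_inv_mem_slitPlane {z : ℂ} (hz : z ∈ slitPlane) : 1 + 1 / z ∈ slitPlane := by
  rw [add_comm, one_div]
  refine add_one_mem_slitPlane ?_
  simpa [moebius, denom, matM] using isNonneg_matM.moebius_mem hz

variable {s lam : ℂ}

theorem IsLewisSolution.congr {φ ψ : ℂ → ℂ} (hφ : IsLewisSolution s lam φ)
    (h : ∀ z ∈ slitPlane, ψ z = φ z) : IsLewisSolution s lam ψ := by
  refine ⟨hφ.1.congr h, fun z hz => ?_⟩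
  rw [h z hz, h _ (add_one_mem_slitPlane hz), h _ (one_add_inv_mem_slitPlane hz), hφ.2 z hz]

theorem IsLewisSolution.sum {ι : Type*} {t : Finset ι} {Φ : ι → ℂ → ℂ}
    (h : ∀ i ∈ t, IsLewisSolution s lam (Φ i)) :
    IsLewisSolution s lam fun z => ∑ i ∈ t, Φ i z := by
  refine ⟨DifferentiableOn.fun_sum fun i hi => (h i hi).1, fun z hz => ?_⟩
  rw [Finset.mul_sum, ← Finset.sum_add_distrib]
  exact Finset.sum_congr rfl fun i hi => (h i hi).2 z hz

theorem IsLewisSystemSolution.sum {n : ℕ} [Fintype (Idx n)] {Φ : Idx n → ℂ → ℂ}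
    (h : IsLewisSystemSolution n s lam Φ) : IsLewisSolution s lam fun z => ∑ i, Φ i z := by
  refine ⟨DifferentiableOn.fun_sum fun i _ => h.1 i, fun z hz => ?_⟩
  -- Each group element permutes the index set, so the total sum does not see the shifts of indices
  -- in the system.
  have key : ∀ (g : GL (Fin 2) ℤ) (w : ℂ), ∑ i : Idx n, Φ (i.act g) w = ∑ i, Φ i w := by
    intro g w
    refine Fintype.sum_equiv (MulAction.toPerm g⁻¹) _ _ fun i => ?_
    rw [MulAction.toPerm_apply, Idx.smul_def, inv_inv]
  have h1 := Finset.sum_eq_zero fun (i : Idx n) (_ : i ∈ Finset.univ) => h.2 i z hz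
  rw [Finset.sum_sub_distrib, Finset.sum_sub_distrib, ← Finset.mul_sum, key, key] at h1
  linear_combination h1

theorem IsLewisSystemSolution.pullback {n m : ℕ} (hmn : m ∣ n) {Φ : Idx m → ℂ → ℂ}
    (h : IsLewisSystemSolution m s lam Φ) :
    IsLewisSystemSolution n s lam fun j => Φ (sigma hmn j) := by
  refine ⟨fun j => h.1 _, fun j z hz => ?_⟩
  simp only [sigma_act]
  exact h.2 _ z hz

theorem isLewisSolution_heckeTTilde {n : ℕ} (hn : 0 < n) (hlam : lam = 1 ∨ lam = -1) {φ : ℂ → ℂ}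
    (hφ : IsLewisSolution s lam φ) : IsLewisSolution s lam (slash s φ (heckeTTilde n)) := by
  have := finite_Idx hn
  let _ := Fintype.ofFinite (Idx n)
  exact (isLewisSystemSolution_psiTilde hn hlam hφ).sum.congr fun z _ =>
    slash_heckeTTilde_eq_sum hn s φ z

end Lewis

/-! ### The main theorem -/

theorem corollary8p4 (n : ℕ) (hn : 0 < n) (s lam : ℂ) (hlam : lam = 1 ∨ lam = -1)
    (φ : ℂ → ℂ) (hφ : Lewis.IsLewisSolution s lam φ) :
    (∀ (d : ℕ) (hd : d ^ 2 ∣ n),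
      Lewis.IsLewisSystemSolution (n / d ^ 2) s lam
        (fun i => Lewis.slash s φ (Lewis.psiTilde (Lewis.quot_pos hn hd) i)) ∧
      Lewis.IsLewisSystemSolution n s lam (fun j => Lewis.phiTilde hn hd s φ j) ∧
      (∀ z ∈ Complex.slitPlane,
        Lewis.phiAverage hn hd s φ z = Lewis.slash s φ (Lewis.heckeTTilde (n / d ^ 2)) z) ∧
      Lewis.IsLewisSolution s lam (Lewis.phiAverage hn hd s φ)) ∧
    Lewis.heckeT n =
      ∑ d ∈ n.divisors with d ^ 2 ∣ n,
        MonoidAlgebra.single (!![(d : ℤ), 0; 0, (d : ℤ)] : Matrix (Fin 2) (Fin 2) ℤ) (1 : ℤ) *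
          Lewis.heckeTTilde (n / d ^ 2) ∧
    (∀ z ∈ Complex.slitPlane,
      Lewis.slash s φ (Lewis.heckeT n) z =
        ∑ d ∈ (n.divisors.filter fun d => d ^ 2 ∣ n).attach,
          Lewis.phiAverage hn (Finset.mem_filter.1 d.2).2 s φ z) ∧
    Lewis.IsLewisSolution s lam (Lewis.slash s φ (Lewis.heckeT n)) := by
  refine ⟨fun d hd => ?_, Lewis.heckeT_eq_sum hn, fun z hz => ?_, ?_⟩
  · have h := Lewis.isLewisSystemSolution_psiTilde (Lewis.quot_pos hn hd) hlam hφ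
    exact ⟨h, h.pullback (Nat.div_dvd_of_dvd hd), fun z _ => Lewis.phiAverage_eq hn hd s φ z,
      (Lewis.isLewisSolution_heckeTTilde (Lewis.quot_pos hn hd) hlam hφ).congr fun z _ =>
        Lewis.phiAverage_eq hn hd s φ z⟩
  · rw [Lewis.slash_heckeT hn s φ hz, ← Finset.sum_attach]
    exact Finset.sum_congr rfl fun d _ => (Lewis.phiAverage_eq hn _ s φ z).symm
  · refine (Lewis.IsLewisSolution.sum fun d hd => Lewis.isLewisSolution_heckeTTilde
      (Lewis.quot_pos hn (Finset.mem_filter.1 hd).2) hlam hφ).congr fun z hz =>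
        Lewis.slash_heckeT hn s φ hz
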